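/- A \emph{strict plane partition} of shape a partition $\lambda=(\lambda_1,\dots,\lambda_r)$ is an array $(\pi_{i,j})_{1\le i\le r,\,1\le j\le\lambda_i}$ of non-negative integers (its \emph{parts}) whose rows are weakly decreasing and whose columns are strictly decreasing; its \emph{norm} $n(\pi)$ is the sum of its parts. Write $[m;q]=1+q+\dots+q^{m-1}$ and $[a;q]_m=\prod_{i=0}^{m-1}[a+i;q]$. \textbf{Theorem.} Let $n\ge 1$, $c\ge 0$ and $0\le k\le c$ be integers. There are only finitely many strict plane partitions $\pi$ with parts in $\{1,2,\dots,n\}$, at most $c$ columns and exactly $k$ parts equal to $n$, and their generating function by norm is $$\sum_{\pi} q^{n(\pi)}=\frac{q^{kn}\,[k+1;q]_{n-1}\,[1+c-k;q]_{n-1}}{[1;q]_{n-1}}\prod_{i=1}^{n-1}\frac{[c+i+1;q]_{i-1}}{[i;q]_i}$$ as an identity in the field $\mathbb{Q}(q)$ of rational functions. -/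

import Mathlib

/-- A strict plane partition: a filling of a Young diagram by non-negative integers whose rows are
weakly decreasing and whose columns are strictly decreasing. Rows and columns are numbered
from `0`; the entry function is normalised to be `0` outside the shape, so that two strict plane
partitions are equal exactly when their shapes and their fillings agree. -/
@[ext]
structure StrictPlanePartition where
  /-- The shape. -/
  shape : YoungDiagram
  /-- The entry in row `i` and column `j`. -/
  entry : ℕ → ℕ → ℕ
  row_weak : ∀ {i j₁ j₂ : ℕ}, j₁ < j₂ → (i, j₂) ∈ shape → entry i j₂ ≤ entry i j₁
  col_strict : ∀ {i₁ i₂ j : ℕ}, i₁ < i₂ → (i₂, j) ∈ shape → entry i₂ j < entry i₁ j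
  zeros : ∀ {i j : ℕ}, (i, j) ∉ shape → entry i j = 0

namespace StrictPlanePartition

/-- The norm, i.e. the sum of the parts. -/
def norm (π : StrictPlanePartition) : ℕ :=
  ∑ x ∈ π.shape.cells, π.entry x.1 x.2

/-- The number of columns, i.e. the length of the first row of the shape. -/
def numCols (π : StrictPlanePartition) : ℕ :=
  π.shape.rowLen 0

/-- The number of parts equal to `m`. -/
def numParts (π : StrictPlanePartition) (m : ℕ) : ℕ :=
  (π.shape.cells.filter fun x => π.entry x.1 x.2 = m).card

/-- All parts lie in `{1, …, n}`. -/
def PartsIn (π : StrictPlanePartition) (n : ℕ) : Prop :=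
  ∀ x ∈ π.shape.cells, 1 ≤ π.entry x.1 x.2 ∧ π.entry x.1 x.2 ≤ n

/-- The strict plane partitions with parts in `{1, …, n}`, at most `c` columns and exactly `k`
parts equal to `n`. -/
def refined (n c k : ℕ) : Set StrictPlanePartition :=
  {π | π.PartsIn n ∧ π.numCols ≤ c ∧ π.numParts n = k}

end StrictPlanePartition

/-- The `q`-integer `[m;q] = 1 + q + ⋯ + q^(m-1)`, as an element of `ℚ(q)`. -/
noncomputable def qInt (m : ℕ) : RatFunc ℚ :=
  ∑ j ∈ Finset.range m, RatFunc.X ^ j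

/-- The `q`-rising factorial `[a;q]_m = [a;q] [a+1;q] ⋯ [a+m-1;q]`, as an element of `ℚ(q)`. -/
noncomputable def qRising (a m : ℕ) : RatFunc ℚ :=
  ∏ i ∈ Finset.range m, qInt (a + i)

/-! Write n = p + 1, let A_k be the generating function for exactly k parts equal to n, and let G(z)
= ∑ A_k z^k. The proof finds linear conditions that determine G up to a scalar.

Encode a shape by l_j = (row length) + j, rows counted from the bottom. Deleting the ones and
lowering all other entries by one matches the branching rule for alternants. Hence det(x_i^(l_j)) in
the variables q, ..., q^p, z q^(p+1) is the generating function of the shape times C ∏_{m=1}^p (z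
q^m - 1), with C independent of z and of the shape (`exists_det_eq_fillingSum`).

The sum of these alternants over all shapes is the top coordinate of an ordered product in an
exterior algebra. As a polynomial in the last variable, its coefficients have differences that are
combinations of the powers x_i^m of the other variables (`exists_sum_alternants`). Therefore, with P
= ∏_{i=1}^{2p+1} (1 - q^i X), the product P G has no terms in degrees p+1, ..., c+p
(`gap_refinedSum`). At most 2p+2 terms remain, and P G vanishes at 2p+1 powers of q⁻¹, so a
Vandermonde argument leaves at most one dimension for G (`eq_zero_of_gap`). The explicit
`refinedWeight` has the same gap, so A_k is proportional to it.

The scalar comes from induction on p: A_0 for p + 1 is the sum of all A_k for p, which q-Vandermonde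
evaluates (`sum_gaussBinom`). -/

open Finset

/-! ### Ordered products of anticommuting elements -/

section OrderedProduct

variable {A : Type*} [Ring A]

/-- The product `f 0 * f 1 * ⋯ * f (m - 1)` in a noncommutative ring. -/
def orderedProd (f : ℕ → A) : ℕ → A
  | 0 => 1
  | m + 1 => orderedProd f m * f m

theorem orderedProd_add (f : ℕ → A) (a b : ℕ) :
    orderedProd f (a + b) = orderedProd f a * orderedProd (fun t => f (a + t)) b := by
  induction b with
  | zero => simp [orderedProd]
  | succ b ih => rw [← add_assoc, orderedProd, ih, orderedProd, mul_assoc]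

theorem orderedProd_succ' (f : ℕ → A) (b : ℕ) :
    orderedProd f (b + 1) = f 0 * orderedProd (fun t => f (1 + t)) b := by
  rw [add_comm, orderedProd_add]; simp [orderedProd]

theorem mul_orderedProd_one_add {y : A} {u : ℕ → A} (h : ∀ l, y * u l = -(u l * y)) (m : ℕ) :
    y * orderedProd (fun l => 1 + u l) m = orderedProd (fun l => 1 - u l) m * y := by
  induction m with
  | zero => simp [orderedProd]
  | succ m ih =>
    rw [orderedProd, ← mul_assoc, ih, orderedProd, mul_assoc, mul_assoc, mul_add, sub_mul, h]
    simp [sub_eq_add_neg]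

theorem mul_orderedProd_one_sub {y : A} {u : ℕ → A} (h : ∀ l, y * u l = -(u l * y)) (m : ℕ) :
    y * orderedProd (fun l => 1 - u l) m = orderedProd (fun l => 1 + u l) m * y := by
  have := mul_orderedProd_one_add (y := y) (u := fun l => -u l) (fun l => by simp [h]) m
  simpa [sub_eq_add_neg] using this

/-- The ordered product of all `1 + u l`, `l < N`, with the factor at `m` deleted and the signs
before it changed. -/
def signedProd (u : ℕ → A) (N m : ℕ) : A :=
  orderedProd (fun l => 1 - u l) m * orderedProd (fun t => 1 + u (m + 1 + t)) (N - 1 - m)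

/-- The two signed products differ only at positions m and m + 1, where the difference is -(u m + u
(m + 1)). Moving that sum to the front restores the earlier signs, and `key` lets it absorb the two
missing factors. -/
theorem signedProd_succ_sub {u : ℕ → A} (hu : ∀ l l', u l * u l' = -(u l' * u l))
    (hs : ∀ l, u l * u l = 0) {N m : ℕ} (hm : m + 1 < N) :
    signedProd u N (m + 1) - signedProd u N m =
      -((u m + u (m + 1)) * orderedProd (fun l => 1 + u l) N) := by
  obtain ⟨b, rfl⟩ : ∃ b, N = m + (b + 1 + 1) := ⟨N - m - 2, by omega⟩
  have hW : ∀ l, (u m + u (m + 1)) * u l = -(u l * (u m + u (m + 1))) := fun l => by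
    rw [add_mul, hu m l, hu (m + 1) l, mul_add]; abel
  have key : (u m + u (m + 1)) * ((1 + u m) * (1 + u (m + 1))) = u m + u (m + 1) := by
    have e1 : u (m + 1) * (u m * u (m + 1)) = 0 := by
      rw [hu m (m + 1), mul_neg, ← mul_assoc, hs]; simp
    have e2 : u m * (u m * u (m + 1)) = 0 := by rw [← mul_assoc, hs]; simp
    have e3 := hu (m + 1) m
    simp only [add_mul, mul_add, mul_one, one_mul, hs, e1, e2, e3]
    abel
  rw [orderedProd_add, ← mul_assoc, mul_orderedProd_one_add hW, orderedProd_succ',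
    orderedProd_succ']
  simp only [signedProd]
  rw [show m + (b + 1 + 1) - 1 - (m + 1) = b by omega,
    show m + (b + 1 + 1) - 1 - m = b + 1 by omega, orderedProd_succ' (fun t => 1 + u (m + 1 + t)),
    orderedProd.eq_2 (fun l => 1 - u l)]
  set a := orderedProd (fun l => 1 - u l) m
  have hf : (fun t => 1 + u (m + (1 + (1 + t)))) = fun t => 1 + u (m + 1 + 1 + t) := by
    funext t; congr 2; ring
  have hf' : (fun t => 1 + u (m + 1 + (1 + t))) = fun t => 1 + u (m + 1 + 1 + t) := by
    funext t; congr 2; ring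
  rw [hf, hf']
  set B := orderedProd (fun t => 1 + u (m + 1 + 1 + t)) b
  have : a * (u m + u (m + 1)) * ((1 + u (m + 0)) * ((1 + u (m + (1 + 0))) * B)) =
      a * ((u m + u (m + 1)) * ((1 + u m) * (1 + u (m + 1)))) * B := by
    simp only [add_zero, mul_assoc]
  rw [this, key]
  simp only [add_zero]
  noncomm_ring

/-- As θ squares to zero, only terms linear in θ survive; moving θ to the front flips the signs of
the factors it passes. -/
theorem orderedProd_one_add_add_smul {R : Type*} [CommRing R] [Algebra R A] {u : ℕ → A} {θ : A}
    (hu : ∀ l, θ * u l = -(u l * θ)) (hs : θ * θ = 0) (w : ℕ → R) (N : ℕ) :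
    orderedProd (fun l => 1 + (u l + w l • θ)) N =
      orderedProd (fun l => 1 + u l) N + ∑ m ∈ range N, w m • (θ * signedProd u N m) := by
  induction N with
  | zero => simp [orderedProd]
  | succ N ih =>
    have h0 : ∀ m, θ * signedProd u N m * θ = 0 := fun m => by
      rw [signedProd, ← mul_assoc, mul_orderedProd_one_sub hu, mul_assoc, mul_assoc,
        ← mul_orderedProd_one_sub (fun l => hu (m + 1 + l)), ← mul_assoc θ, hs]
      simp
    have h1 : ∀ m ∈ range N, signedProd u (N + 1) m = signedProd u N m * (1 + u N) := by
      intro m hm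
      rw [mem_range] at hm
      obtain ⟨b, rfl⟩ : ∃ b, N = m + 1 + b := ⟨N - m - 1, by omega⟩
      rw [signedProd, signedProd, show m + 1 + b + 1 - 1 - m = b + 1 by omega,
        show m + 1 + b - 1 - m = b by omega, orderedProd, mul_assoc]
    have h2 : θ * signedProd u (N + 1) N = orderedProd (fun l => 1 + u l) N * θ := by
      rw [signedProd, ← mul_assoc, mul_orderedProd_one_sub hu]
      simp [orderedProd]
    have h3 : ∑ m ∈ range N, w m • (θ * signedProd u (N + 1) m) =
        (∑ m ∈ range N, w m • (θ * signedProd u N m)) * (1 + u N) := by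
      rw [Finset.sum_mul]
      refine sum_congr rfl fun m hm => ?_
      rw [h1 m hm, smul_mul_assoc, mul_assoc]
    have h4 : (∑ m ∈ range N, w m • (θ * signedProd u N m)) * θ = 0 := by
      rw [Finset.sum_mul]
      exact sum_eq_zero fun m _ => by rw [smul_mul_assoc, h0, smul_zero]
    rw [orderedProd, ih, orderedProd, sum_range_succ, h2, h3, ← add_assoc, mul_add, add_mul,
      mul_smul_comm, add_mul, h4, add_zero]
    abel

end OrderedProduct

/-! ### Strictly increasing sequences -/

/-- The strictly increasing maps `Fin n → ℕ` with values less than `N`. -/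
def strictMonoBelow (n N : ℕ) : Finset (Fin n → ℕ) :=
  (Fintype.piFinset fun _ => range N).filter fun l => ∀ i j, i < j → l i < l j

theorem mem_strictMonoBelow {n N : ℕ} {l : Fin n → ℕ} :
    l ∈ strictMonoBelow n N ↔ StrictMono l ∧ ∀ i, l i < N := by
  simp only [strictMonoBelow, mem_filter, Fintype.mem_piFinset, mem_range, StrictMono]
  tauto

theorem sum_strictMonoBelow_succ {M : Type*} [AddCommMonoid M] (n N : ℕ)
    (f : (Fin (n + 1) → ℕ) → M) :
    ∑ l ∈ strictMonoBelow (n + 1) (N + 1), f l =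
      ∑ l ∈ strictMonoBelow (n + 1) N, f l +
        ∑ l ∈ strictMonoBelow n N, f (Fin.snoc l N) := by
  rw [← sum_filter_add_sum_filter_not _ (fun l => l (Fin.last n) < N)]
  congr 1
  · refine sum_congr ?_ fun _ _ => rfl
    ext l
    simp only [mem_filter, mem_strictMonoBelow]
    constructor
    · rintro ⟨⟨h1, -⟩, h3⟩
      exact ⟨h1, fun i => (h1.monotone (Fin.le_last i)).trans_lt h3⟩
    · rintro ⟨h1, h2⟩
      exact ⟨⟨h1, fun i => (h2 i).trans (Nat.lt_succ_self N)⟩, h2 _⟩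
  · refine sum_nbij' (fun l => Fin.init l) (fun l => Fin.snoc l N) ?_ ?_ ?_ ?_ ?_
    · intro l hl
      simp only [mem_filter, mem_strictMonoBelow] at hl
      obtain ⟨⟨h1, h2⟩, h3⟩ := hl
      refine mem_strictMonoBelow.2 ⟨fun i j hij => h1 (Fin.castSucc_lt_castSucc_iff.2 hij), fun i => ?_⟩
      have := h1 (Fin.castSucc_lt_last i)
      have := h2 (Fin.last n)
      simp only [Fin.init]
      omega
    · intro l hl
      rw [mem_strictMonoBelow] at hl
      simp only [mem_filter, mem_strictMonoBelow, Fin.snoc_last, lt_irrefl, not_false_eq_true,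
        and_true]
      refine ⟨fun i j hij => ?_, fun i => ?_⟩
      · induction j using Fin.lastCases with
        | last =>
          induction i using Fin.lastCases with
          | last => simp at hij
          | cast i => simpa using hl.2 i
        | cast j =>
          induction i using Fin.lastCases with
          | last => exact absurd hij (not_lt.2 (Fin.le_last _))
          | cast i => simpa using hl.1 (Fin.castSucc_lt_castSucc_iff.1 hij)
      · induction i using Fin.lastCases with
        | last => simp
        | cast i => simpa using (hl.2 i).trans (Nat.lt_succ_self N)
    · intro l hl
      simp only [mem_filter, mem_strictMonoBelow] at hl
      have : l (Fin.last n) = N := by have := hl.1.2 (Fin.last n); omega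
      rw [← this]; exact Fin.snoc_init_self l
    · intro l _; exact Fin.init_snoc ..
    · intro l hl
      simp only [mem_filter, mem_strictMonoBelow] at hl
      have : l (Fin.last n) = N := by have := hl.1.2 (Fin.last n); omega
      rw [← this, Fin.snoc_init_self l]

theorem strictMonoBelow_eq_empty {n N : ℕ} (h : N < n) : strictMonoBelow n N = ∅ := by
  refine eq_empty_of_forall_notMem fun l hl => ?_
  rw [mem_strictMonoBelow] at hl
  have : Fintype.card (Fin n) ≤ Fintype.card (Fin N) :=
    Fintype.card_le_of_injective (fun i => (⟨l i, hl.2 i⟩ : Fin N)) fun i j hij =>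
      hl.1.injective (by simpa using hij)
  simp at this
  omega

/-! ### Sums of alternants through the exterior algebra -/

section Exterior

variable {R : Type*} [CommRing R]

theorem ιMulti_snoc {M : Type*} [AddCommGroup M] [Module R M] (n : ℕ) (v : Fin n → M) (y : M) :
    ExteriorAlgebra.ιMulti R (n + 1) (Fin.snoc v y : Fin (n + 1) → M) =
      ExteriorAlgebra.ιMulti R n v * ExteriorAlgebra.ι R y := by
  rw [ExteriorAlgebra.ιMulti_apply, ExteriorAlgebra.ιMulti_apply, List.ofFn_succ',
    List.concat_eq_append, List.prod_append]
  simp only [Fin.snoc_castSucc, Fin.snoc_last, List.prod_singleton]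

theorem orderedProd_one_add_ι {M : Type*} [AddCommGroup M] [Module R M] (v : ℕ → M) (N : ℕ) :
    orderedProd (fun l => 1 + ExteriorAlgebra.ι R (v l)) N =
      ∑ n ∈ range (N + 1), ∑ l ∈ strictMonoBelow n N,
        ExteriorAlgebra.ιMulti R n (fun j => v (l j)) := by
  induction N with
  | zero =>
    have : strictMonoBelow 0 0 = {Fin.elim0} := by
      ext l; simp [mem_strictMonoBelow, Subsingleton.elim l Fin.elim0, StrictMono]
    simp [orderedProd, this, ExteriorAlgebra.ιMulti_apply]
  | succ N ih =>
    have h0 : ∀ N, strictMonoBelow 0 N = {Fin.elim0} := fun N => by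
      ext l; simp [mem_strictMonoBelow, Subsingleton.elim l Fin.elim0, StrictMono]
    rw [sum_range_succ' _ (N + 1), sum_congr rfl (fun n _ => sum_strictMonoBelow_succ n N _),
      sum_add_distrib, orderedProd, mul_add, mul_one]
    have e1 : ∀ (n : ℕ) (l : Fin n → ℕ),
        ExteriorAlgebra.ιMulti R (n + 1) (fun j => v ((Fin.snoc l N : Fin (n + 1) → ℕ) j)) =
          ExteriorAlgebra.ιMulti R n (fun j => v (l j)) * ExteriorAlgebra.ι R (v N) := fun n l => by
      rw [← ιMulti_snoc]
      congr 1
      exact Fin.comp_snoc v l N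
    simp only [e1, ← sum_mul]
    rw [← ih, sum_range_succ, strictMonoBelow_eq_empty (Nat.lt_succ_self N), sum_empty, add_zero,
      add_right_comm]
    congr 1
    rw [h0, ← h0 N, ih, sum_range_succ']

/-- The coordinate of top degree in the exterior algebra of `Rⁿ`. -/
noncomputable def topCoord (R : Type*) [CommRing R] (n : ℕ) :
    ExteriorAlgebra R (Fin n → R) →ₗ[R] R :=
  ExteriorAlgebra.liftAlternating (R := R)
    (Function.update 0 n (Matrix.detRowAlternating (R := R) (n := Fin n)))

/-- The product expands into wedges over increasing sequences; only those of length n have a top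
coordinate, which is a determinant. -/
theorem topCoord_orderedProd (n N : ℕ) (v : ℕ → Fin n → R) :
    topCoord R n (orderedProd (fun l => 1 + ExteriorAlgebra.ι R (v l)) N) =
      ∑ l ∈ strictMonoBelow n N, Matrix.det (Matrix.of fun j => v (l j)) := by
  rw [orderedProd_one_add_ι, map_sum]
  have h : ∀ n' (l : Fin n' → ℕ), topCoord R n (ExteriorAlgebra.ιMulti R n' (fun j => v (l j))) =
      Function.update (0 : (i : ℕ) → (Fin n → R) [⋀^Fin i]→ₗ[R] R) n
        (Matrix.detRowAlternating (R := R) (n := Fin n)) n' (fun j => v (l j)) := fun n' l =>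
    ExteriorAlgebra.liftAlternating_apply_ιMulti ..
  rw [sum_eq_single n]
  · rw [map_sum]
    refine sum_congr rfl fun l _ => ?_
    rw [h, Function.update_self]; rfl
  · intro n' _ hn
    rw [map_sum]
    refine sum_eq_zero fun l _ => ?_
    rw [h, Function.update_of_ne hn]; rfl
  · intro hn
    rw [strictMonoBelow_eq_empty (by simpa using hn)]; simp

/-- The sum of all alternants with exponents less than `N`, as a polynomial in one of its
variables. -/
theorem exists_sum_alternants {p : ℕ} (x : Fin p → R) (N : ℕ) :
    ∃ (g : ℕ → R) (c : Fin p → R),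
      (∀ w : R, ∑ l ∈ strictMonoBelow (p + 1) N,
        Matrix.det (Matrix.of fun j i => (Fin.snoc x w : Fin (p + 1) → R) i ^ l j) =
          ∑ m ∈ range N, g m * w ^ m) ∧
      ∀ m, m + 1 < N → g (m + 1) - g m = ∑ i, c i * x i ^ m := by
  set ι := ExteriorAlgebra.ι R (M := Fin (p + 1) → R)
  set e : Fin (p + 1) → Fin (p + 1) → R := fun i => Pi.single i 1
  set v : ℕ → Fin (p + 1) → R := fun l => ∑ i, x i ^ l • e i.castSucc
  set u : ℕ → ExteriorAlgebra R (Fin (p + 1) → R) := fun l => ι (v l)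
  set θ := ι (e (Fin.last p))
  have anti : ∀ a b, ι a * ι b = -(ι b * ι a) := fun a b =>
    eq_neg_of_add_eq_zero_left (ExteriorAlgebra.ι_add_mul_swap a b)
  have sq : ∀ a, ι a * ι a = 0 := fun a => ExteriorAlgebra.ι_sq_zero a
  -- The term linear in θ supplies g; the constants come from expanding u m + u (m + 1) as ∑ x_i^m
  -- (1 + x_i) e_i in `signedProd_succ_sub`.
  refine ⟨fun m => topCoord R (p + 1) (θ * signedProd u N m),
    fun i => -((1 + x i) * topCoord R (p + 1)
      (θ * (ι (e i.castSucc) * orderedProd (fun l => 1 + u l) N))), ?_, ?_⟩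
  · intro w
    have hv : ∀ l : ℕ, (fun i => (Fin.snoc x w : Fin (p + 1) → R) i ^ l) =
        v l + w ^ l • e (Fin.last p) := fun l => by
      rw [pi_eq_sum_univ' (fun i => (Fin.snoc x w : Fin (p + 1) → R) i ^ l), Fin.sum_univ_castSucc]
      simp [v, e]
    have h1 := topCoord_orderedProd (p + 1) N
      (fun l => fun i => (Fin.snoc x w : Fin (p + 1) → R) i ^ l)
    refine Eq.trans h1.symm ?_
    have h2 : (fun l => 1 + ι ((fun i => (Fin.snoc x w : Fin (p + 1) → R) i ^ l))) =
        fun l => 1 + (u l + w ^ l • θ) := by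
      funext l; rw [hv, map_add, map_smul]
    rw [h2, orderedProd_one_add_add_smul (fun l => anti _ _) (sq _) (fun l => w ^ l), map_add,
      topCoord_orderedProd, map_sum]
    -- Without θ all vectors lie in a coordinate hyperplane, so these determinants have a zero
    -- column.
    rw [sum_eq_zero, zero_add]
    · refine sum_congr rfl fun m _ => ?_
      rw [map_smul, smul_eq_mul, mul_comm]
    · intro l _
      refine Matrix.det_eq_zero_of_column_eq_zero (Fin.last p) fun j => ?_
      simp [v, e, Finset.sum_apply, Fin.ext_iff, (Fin.is_lt _).ne']
  · intro m hm
    rw [← map_sub, ← mul_sub, signedProd_succ_sub (fun l l' => anti _ _) (fun l => sq _) hm]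
    have : u m + u (m + 1) = ∑ i, (x i ^ m * (1 + x i)) • ι (e i.castSucc) := by
      simp only [u, v, map_sum, map_smul, ← sum_add_distrib, ← add_smul]
      refine sum_congr rfl fun i _ => ?_
      congr 1; ring
    rw [this, mul_neg, map_neg, sum_mul, mul_sum, map_sum, ← sum_neg_distrib]
    refine sum_congr rfl fun i _ => ?_
    rw [smul_mul_assoc, mul_smul_comm, map_smul, smul_eq_mul]
    ring

end Exterior

/-! ### Branching of alternants -/

section Alternant

variable {R : Type*} [CommRing R]

theorem det_sum_smul_rows {n : ℕ} (A : Fin n → Finset ℕ) (a : Fin n → ℕ → R)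
    (v : ℕ → Fin n → R) :
    Matrix.det (Matrix.of fun j i => ∑ m ∈ A j, a j m * v m i) =
      ∑ l ∈ Fintype.piFinset A, (∏ j, a j (l j)) * Matrix.det (Matrix.of fun j i => v (l j) i) := by
  have h := (Matrix.detRowAlternating (R := R) (n := Fin n)).toMultilinearMap.map_sum_finset
    (fun j m => a j m • v m) A
  have e : (Matrix.of fun j i => ∑ m ∈ A j, a j m * v m i : Matrix (Fin n) (Fin n) R) =
      fun j => ∑ m ∈ A j, a j m • v m := by
    ext j i; simp [Finset.sum_apply]
  rw [e]
  refine Eq.trans h (sum_congr rfl fun l _ => ?_)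
  exact (Matrix.detRowAlternating (R := R) (n := Fin n)).toMultilinearMap.map_smul_univ
    (fun j => a j (l j)) (fun j => v (l j))

/-- The branching rule for alternants. -/
theorem det_alternant_cons {n : ℕ} (x : Fin n → R) (y : R) {l : Fin (n + 1) → ℕ}
    (hl : Monotone l) :
    Matrix.det (Matrix.of fun j i => (Fin.cons y x : Fin (n + 1) → R) i ^ l j) =
      y ^ l 0 * (∏ i, (x i - y)) *
        ∑ l' ∈ Fintype.piFinset fun j : Fin n => Ico (l j.castSucc) (l j.succ),
          (∏ j, y ^ (l j.succ - 1 - l' j)) * Matrix.det (Matrix.of fun j i => x i ^ l' j) := by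
  set A : Matrix (Fin (n + 1)) (Fin (n + 1)) R :=
    Matrix.of fun j i => (Fin.cons y x : Fin (n + 1) → R) i ^ l j with hA
  -- Subtracting from each row a power of y times its predecessor clears the first column below the
  -- top; the other entries then factor as x_i - y times a geometric sum.
  set B : Matrix (Fin (n + 1)) (Fin (n + 1)) R := Matrix.of
    (Fin.cons (A 0) fun j i => A j.succ i - y ^ (l j.succ - l j.castSucc) * A j.castSucc i :
      Fin (n + 1) → Fin (n + 1) → R) with hB
  have hAB : A.det = B.det := by
    refine Matrix.det_eq_of_forall_row_eq_smul_add_pred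
      (fun j => y ^ (l j.succ - l j.castSucc)) (fun i => ?_) (fun j i => ?_)
    · simp [hB]
    · simp [hB]
  have hle : ∀ j : Fin n, l j.castSucc ≤ l j.succ := fun j => hl (Fin.castSucc_le_succ j)
  have hB0 : ∀ j : Fin n, B j.succ 0 = 0 := fun j => by
    simp [hB, hA, ← pow_add, Nat.sub_add_cancel (hle j)]
  have hBs : B.submatrix Fin.succ Fin.succ = Matrix.of fun j i => (x i - y) *
      (Matrix.of fun (j : Fin n) i => ∑ m ∈ Ico (l j.castSucc) (l j.succ),
        y ^ (l j.succ - 1 - m) * (fun m (i : Fin n) => x i ^ m) m i) j i := by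
    ext j i
    simp only [hB, hA, Matrix.submatrix_apply, Matrix.of_apply, Fin.cons_succ]
    obtain ⟨d, hd⟩ := Nat.exists_eq_add_of_le (hle j)
    rw [hd, sum_Ico_eq_sum_range, Nat.add_sub_cancel_left, pow_add,
      mul_comm (y ^ d), ← mul_sub, ← (Commute.all (x i) y).geom_sum₂_mul d, mul_comm (x i - y),
      ← mul_assoc, mul_sum]
    congr 1
    refine sum_congr rfl fun t ht => ?_
    rw [mem_range] at ht
    rw [show l j.castSucc + d - 1 - (l j.castSucc + t) = d - 1 - t by omega, pow_add]
    ring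
  rw [hAB, Matrix.det_succ_column_zero, sum_eq_single 0]
  · rw [Fin.succAbove_zero, hBs, Matrix.det_mul_row, det_sum_smul_rows]
    simp [hB, hA, mul_assoc]
  · intro j _ hj
    obtain ⟨j, rfl⟩ := Fin.exists_succ_eq.2 hj
    rw [hB0]; simp
  · simp

theorem det_alternant_mul {n : ℕ} (x : Fin n → R) (q : R) (l : Fin n → ℕ) :
    Matrix.det (Matrix.of fun j i => (q * x i) ^ l j) =
      q ^ (∑ j, l j) * Matrix.det (Matrix.of fun j i => x i ^ l j) := by
  simp only [mul_pow]
  rw [← prod_pow_eq_pow_sum]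
  exact Matrix.det_mul_column (fun j => q ^ l j) (Matrix.of fun j i => x i ^ l j)

/-- With y = q and the other variables scaled by q, the powers of q in each summand combine to
exponent ∑ l_j - n, independent of l'; the branching sum becomes unweighted. -/
theorem det_alternant_cons_mul {n : ℕ} (x : Fin n → R) (q : R) {l : Fin (n + 1) → ℕ}
    (hl : Monotone l) :
    q ^ n * Matrix.det
        (Matrix.of fun j i => (Fin.cons q fun i => q * x i : Fin (n + 1) → R) i ^ l j) =
      q ^ (∑ j, l j) * (∏ i, (q * x i - q)) *
        ∑ l' ∈ Fintype.piFinset fun j : Fin n => Ico (l j.castSucc) (l j.succ),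
          Matrix.det (Matrix.of fun j i => x i ^ l' j) := by
  rw [det_alternant_cons _ _ hl, mul_sum, mul_sum, mul_sum]
  refine sum_congr rfl fun l' hl' => ?_
  rw [det_alternant_mul, prod_pow_eq_pow_sum, Fin.sum_univ_succ, pow_add]
  have : ∑ j : Fin n, l j.succ = n + ∑ j : Fin n, (l j.succ - 1 - l' j) + ∑ j, l' j := by
    have h1 : ∑ j : Fin n, l j.succ = ∑ j : Fin n, (1 + (l j.succ - 1 - l' j) + l' j) :=
      sum_congr rfl fun j _ => by
        have := mem_Ico.1 (Fintype.mem_piFinset.1 hl' j)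
        omega
    rw [h1, sum_add_distrib, sum_add_distrib]
    simp
  rw [this, pow_add, pow_add]
  ring

end Alternant

/-! ### Fillings and removal of the ones -/

/-- Column-strict fillings with `n + 1` rows, numbered from the last row to the first. The entries
of row `j` are at most `j + 1` and its length is `l j - j`. -/
structure IsFilling (n : ℕ) (l : Fin (n + 1) → ℕ) (e : Fin (n + 1) → ℕ → ℕ) : Prop where
  supp : ∀ j t, e j t ≠ 0 ↔ t + j < l j
  row : ∀ j t, e j (t + 1) ≤ e j t
  col : ∀ i j t, i < j → e i t ≠ 0 → e i t < e j t
  le : ∀ j t, e j t ≤ j + 1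

namespace IsFilling

variable {n : ℕ} {l l' : Fin (n + 1) → ℕ} {e : Fin (n + 1) → ℕ → ℕ}

theorem eq_zero (h : IsFilling n l e) {j : Fin (n + 1)} {t : ℕ} (ht : l j ≤ t + j) : e j t = 0 := by
  by_contra h0
  exact absurd ((h.supp j t).1 h0) (not_lt.2 ht)

theorem shape_unique (h : IsFilling n l e) (h' : IsFilling n l' e)
    (hl : ∀ j : Fin (n + 1), (j : ℕ) ≤ l j) (hl' : ∀ j : Fin (n + 1), (j : ℕ) ≤ l' j) : l = l' := by
  funext j
  have h1 := fun t => (h.supp j t).symm.trans (h'.supp j t)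
  have h2 := h1 (l j - j)
  have h3 := h1 (l' j - j)
  have := hl j
  have := hl' j
  omega

end IsFilling

theorem StrictMono.val_le_apply {n : ℕ} {l : Fin n → ℕ} (hl : StrictMono l) (j : Fin n) :
    (j : ℕ) ≤ l j := by
  obtain ⟨j, hj⟩ := j
  induction j with
  | zero => simp
  | succ j ih =>
    have := ih (by omega)
    have h2 : l ⟨j, by omega⟩ < l ⟨j + 1, hj⟩ := hl (by simp)
    simp only at this ⊢
    omega

/-- Increase all entries by one and fill up the shape `l` with ones. -/
def liftFilling {n : ℕ} (l : Fin (n + 2) → ℕ) (e : Fin (n + 1) → ℕ → ℕ) :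
    Fin (n + 2) → ℕ → ℕ :=
  fun j t => if t + j < l j then (Fin.cons (fun _ => 0) e : Fin (n + 2) → ℕ → ℕ) j t + 1 else 0

/-- The strict interlacing sequences. -/
def interlacing {n : ℕ} (l : Fin (n + 2) → ℕ) : Finset (Fin (n + 1) → ℕ) :=
  Fintype.piFinset fun j => Ico (l j.castSucc) (l j.succ)

section

variable {n : ℕ} {l : Fin (n + 2) → ℕ}

theorem mem_interlacing {l' : Fin (n + 1) → ℕ} :
    l' ∈ interlacing l ↔ ∀ j, l j.castSucc ≤ l' j ∧ l' j < l j.succ := by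
  simp [interlacing]

theorem strictMono_of_mem_interlacing {l' : Fin (n + 1) → ℕ} (h : l' ∈ interlacing l) :
    StrictMono l' := by
  rw [mem_interlacing] at h
  refine Fin.strictMono_iff_lt_succ.2 fun j => ?_
  have h1 := (h j.castSucc).2
  have h2 := (h j.succ).1
  rw [Fin.succ_castSucc] at h1
  exact h1.trans_le h2

variable {l' : Fin (n + 1) → ℕ} {e : Fin (n + 1) → ℕ → ℕ}

theorem IsFilling.lift_sub_one (h : IsFilling n l' e) (hl : l' ∈ interlacing l) :
    (fun (j : Fin (n + 1)) t => liftFilling l e j.succ t - 1) = e := by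
  funext j t
  simp only [liftFilling, Fin.cons_succ, Fin.val_succ]
  split_ifs with h1
  · simp
  · refine (h.eq_zero ?_).symm
    have := (mem_interlacing.1 hl j).2
    omega

/-- Interlacing says that the new ones form a horizontal strip: each cell has an old nonzero entry
above it in its column, unless it lies in the top row. -/
theorem IsFilling.lift (h : IsFilling n l' e) (hl : l' ∈ interlacing l) :
    IsFilling (n + 1) l (liftFilling l e) := by
  have hl' := mem_interlacing.1 hl
  refine ⟨fun j t => ?_, fun j t => ?_, ?_, fun j t => ?_⟩
  · simp [liftFilling]
  · simp only [liftFilling]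
    split_ifs with h1 h2 h2
    · refine Nat.succ_le_succ ?_
      induction j using Fin.cases with
      | zero => simp
      | succ j => simpa using h.row j t
    · omega
    · simp
    · simp
  · have key : ∀ (i j : Fin (n + 1)) t, i ≤ j → liftFilling l e i.castSucc t ≠ 0 →
        liftFilling l e i.castSucc t < liftFilling l e j.succ t := by
      intro i j t hij h0
      have h1 : t + i < l i.castSucc := by
        by_contra h1
        exact h0 (by simp only [liftFilling, Fin.val_castSucc, if_neg h1])
      have h2 := hl' i
      have hei : e i t ≠ 0 := (h.supp i t).2 (by omega)
      have hle : e i t ≤ e j t := by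
        rcases hij.eq_or_lt with rfl | hij
        · exact le_rfl
        · exact (h.col i j t hij hei).le
      have h3 : t + j < l' j := (h.supp j t).1 (by omega)
      have h4 := hl' j
      simp only [liftFilling, Fin.val_castSucc, if_pos h1, Fin.val_succ, Fin.cons_succ]
      rw [if_pos (by omega)]
      refine Nat.succ_lt_succ (lt_of_lt_of_le ?_ hle)
      obtain ⟨i, hi⟩ := i
      cases i with
      | zero => exact Nat.pos_of_ne_zero hei
      | succ i =>
        rcases eq_or_ne (e ⟨i, by omega⟩ t) 0 with hne | hne
        · exact lt_of_eq_of_lt hne (Nat.pos_of_ne_zero hei)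
        · exact h.col ⟨i, by omega⟩ ⟨i + 1, hi⟩ t (by simp) hne
    intro i j t hij h0
    obtain ⟨j, rfl⟩ := Fin.exists_succ_eq.2 (Fin.ne_zero_of_lt hij)
    obtain ⟨i, rfl⟩ := Fin.exists_castSucc_eq.2 (Fin.ne_last_of_lt hij)
    exact key i j t (Fin.castSucc_lt_succ_iff.1 hij) h0
  · simp only [liftFilling]
    split_ifs
    · induction j using Fin.cases with
      | zero => simp
      | succ j => simpa using h.le j t
    · simp

/-- The inverse lowers every entry by one and drops the bottom row, whose entries are at most 1. The
new row lengths are the first positions where the lowered rows vanish. -/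
theorem IsFilling.exists_eq_lift (hl : StrictMono l) {e : Fin (n + 2) → ℕ → ℕ}
    (h : IsFilling (n + 1) l e) :
    ∃ l' ∈ interlacing l, ∃ e', IsFilling n l' e' ∧ liftFilling l e' = e := by
  have hfin : ∀ j : Fin (n + 1), ∃ t, e j.succ t - 1 = 0 := fun j =>
    ⟨l j.succ, by rw [h.eq_zero (by omega)]⟩
  have hanti : ∀ j : Fin (n + 1), Antitone fun t => e j.succ t - 1 := fun j =>
    antitone_nat_of_succ_le fun t => Nat.sub_le_sub_right (h.row _ t) 1
  have hfind : ∀ (j : Fin (n + 1)) t, e j.succ t - 1 ≠ 0 ↔ t < Nat.find (hfin j) := fun j t => by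
    constructor
    · intro h0
      by_contra h1
      have := hanti j (not_lt.1 h1)
      have := Nat.find_spec (hfin j)
      simp only at *
      omega
    · exact fun h1 => Nat.find_min (hfin j) h1
  refine ⟨fun j => Nat.find (hfin j) + j, ?_, fun j t => e j.succ t - 1, ⟨?_, ?_, ?_, ?_⟩, ?_⟩
  · rw [mem_interlacing]
    intro j
    constructor
    · by_contra hlt
      have h1 : e j.castSucc (Nat.find (hfin j)) ≠ 0 := (h.supp _ _).2 (by simpa using hlt)
      have h2 := h.col j.castSucc j.succ _ (Fin.castSucc_lt_succ) h1
      have h3 := Nat.find_spec (hfin j)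
      omega
    · have h0 := hl.val_le_apply j.succ
      rw [Fin.val_succ] at h0
      have h1 : e j.succ (l j.succ - (j + 1)) = 0 := h.eq_zero (by rw [Fin.val_succ]; omega)
      have h2 : Nat.find (hfin j) ≤ l j.succ - (j + 1) := Nat.find_min' _ (by rw [h1])
      omega
  · intro j t
    rw [hfind]
    omega
  · exact fun j t => Nat.sub_le_sub_right (h.row _ t) 1
  · intro i j t hij h0
    have := h.col i.succ j.succ t (Fin.succ_lt_succ_iff.2 hij) (by omega)
    omega
  · intro j t
    have := h.le j.succ t
    rw [Fin.val_succ] at this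
    omega
  · funext j t
    simp only [liftFilling]
    split_ifs with h1
    · have h2 := (h.supp j t).2 h1
      induction j using Fin.cases with
      | zero => have := h.le 0 t; simp at this ⊢; omega
      | succ j => simp; omega
    · exact (h.eq_zero (not_lt.1 h1)).symm

end

theorem isFilling_zero {l : Fin 1 → ℕ} {e : Fin 1 → ℕ → ℕ} :
    IsFilling 0 l e ↔ e = fun _ t => if t < l 0 then 1 else 0 := by
  constructor
  · intro h
    funext j t
    obtain rfl := Subsingleton.elim j 0
    have h1 := h.supp 0 t
    have h2 := h.le 0 t
    simp only [Fin.val_zero, add_zero, zero_add] at h1 h2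
    split_ifs with h3
    · have := h1.2 h3; omega
    · by_contra h4; exact h3 (h1.1 h4)
  · rintro rfl
    refine ⟨fun j t => ?_, fun j t => ?_, fun i j t hij => ?_, fun j t => ?_⟩
    · obtain rfl := Subsingleton.elim (α := Fin 1) j 0
      simp
    · split_ifs <;> omega
    · exact absurd hij (by simp [Subsingleton.elim (α := Fin 1) i j])
    · split_ifs <;> omega

open Classical in
/-- All fillings of shape `l`. -/
noncomputable def fillings : (n : ℕ) → (Fin (n + 1) → ℕ) → Finset (Fin (n + 1) → ℕ → ℕ)
  | 0, l => {fun _ t => if t < l 0 then 1 else 0}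
  | n + 1, l => (interlacing l).biUnion fun l' => (fillings n l').image (liftFilling l)

theorem mem_fillings {n : ℕ} {l : Fin (n + 1) → ℕ} (hl : StrictMono l)
    {e : Fin (n + 1) → ℕ → ℕ} : e ∈ fillings n l ↔ IsFilling n l e := by
  induction n with
  | zero => simp [fillings, isFilling_zero]
  | succ n ih =>
    simp only [fillings, mem_biUnion, mem_image]
    constructor
    · rintro ⟨l', hl', e', he', rfl⟩
      exact ((ih (strictMono_of_mem_interlacing hl')).1 he').lift hl'
    · intro h
      obtain ⟨l', hl', e', he', h⟩ := h.exists_eq_lift hl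
      exact ⟨l', hl', e', (ih (strictMono_of_mem_interlacing hl')).2 he', h⟩

/-- The sum of the entries in the first `M` columns. -/
def fillingNorm (M : ℕ) {n : ℕ} (e : Fin (n + 1) → ℕ → ℕ) : ℕ :=
  ∑ j, ∑ t ∈ range M, e j t

/-- The number of entries `n + 1` in the top row and the first `M` columns. -/
def fillingTop (M : ℕ) {n : ℕ} (e : Fin (n + 1) → ℕ → ℕ) : ℕ :=
  #{t ∈ range M | e (Fin.last n) t = n + 1}

/-- Lifting adds one for each cell of the new shape, and row j has l j - j cells; the additive form
avoids truncated subtraction. -/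
theorem fillingNorm_lift {M n : ℕ} {l : Fin (n + 2) → ℕ} {l' : Fin (n + 1) → ℕ}
    {e : Fin (n + 1) → ℕ → ℕ} (h : IsFilling n l' e) (hl' : l' ∈ interlacing l)
    (hl : StrictMono l) (hM : ∀ j, l j ≤ M) :
    ∑ j : Fin (n + 2), (j : ℕ) + fillingNorm M (liftFilling l e) =
      ∑ j, l j + fillingNorm M e := by
  have h1 : ∀ j : Fin (n + 2), j + ∑ t ∈ range M, liftFilling l e j t =
      l j + ∑ t ∈ range M, (Fin.cons (fun _ => 0) e : Fin (n + 2) → ℕ → ℕ) j t := by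
    intro j
    have h2 : ∀ t, liftFilling l e j t = (if t + j < l j then 1 else 0) +
        (Fin.cons (fun _ => 0) e : Fin (n + 2) → ℕ → ℕ) j t := by
      intro t
      simp only [liftFilling]
      split_ifs with h3
      · ring
      · induction j using Fin.cases with
        | zero => simp
        | succ j =>
          rw [Fin.val_succ] at h3
          have := (mem_interlacing.1 hl' j).2
          rw [Fin.cons_succ, h.eq_zero (by omega)]
    have h4 : (range M).filter (fun t => t + (j : ℕ) < l j) = range (l j - j) := by
      ext t
      have := hM j
      simp only [mem_filter, mem_range]
      omega
    have := hl.val_le_apply j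
    rw [sum_congr rfl fun t _ => h2 t, sum_add_distrib, ← card_filter, h4, card_range]
    omega
  simp only [fillingNorm]
  rw [← sum_add_distrib, sum_congr rfl fun j _ => h1 j, sum_add_distrib,
    Fin.sum_univ_succ fun j : Fin (n + 2) =>
      ∑ t ∈ range M, (Fin.cons (fun _ => 0) e : Fin (n + 2) → ℕ → ℕ) j t]
  simp

theorem fillingTop_lift {M n : ℕ} {l : Fin (n + 2) → ℕ} {l' : Fin (n + 1) → ℕ}
    {e : Fin (n + 1) → ℕ → ℕ} (h : IsFilling n l' e) (hl' : l' ∈ interlacing l) :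
    fillingTop M (liftFilling l e) = fillingTop M e := by
  simp only [fillingTop]
  congr 1
  refine filter_congr fun t _ => ?_
  rw [← Fin.succ_last, liftFilling, Fin.cons_succ]
  have h1 := h.supp (Fin.last n) t
  have h2 := (mem_interlacing.1 hl' (Fin.last n)).2
  rw [Fin.val_last] at h1
  rw [Fin.val_succ, Fin.val_last]
  split_ifs with h3
  · omega
  · have h4 : e (Fin.last n) t = 0 := by
      by_contra h5
      have := h1.1 h5
      omega
    simp [h4]

/-! ### Generating functions of a fixed shape -/

section

variable {R : Type*} [CommRing R] (q z : R) (M : ℕ)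

/-- The generating function of the fillings of a given shape. -/
noncomputable def fillingSum (n : ℕ) (l : Fin (n + 1) → ℕ) : R :=
  ∑ e ∈ fillings n l, q ^ fillingNorm M e * z ^ fillingTop M e

theorem fillingSum_zero {l : Fin 1 → ℕ} (hM : l 0 ≤ M) :
    fillingSum q z M 0 l = (q * z) ^ l 0 := by
  have h4 : (range M).filter (fun t => t < l 0) = range (l 0) := by
    ext t
    simp only [mem_filter, mem_range]
    omega
  simp [fillingSum, fillings, fillingNorm, fillingTop, h4, mul_pow]

theorem fillingSum_succ {n : ℕ} {l : Fin (n + 2) → ℕ} (hl : StrictMono l) (hM : ∀ j, l j ≤ M) :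
    q ^ (∑ j : Fin (n + 2), (j : ℕ)) * fillingSum q z M (n + 1) l =
      q ^ (∑ j, l j) * ∑ l' ∈ interlacing l, fillingSum q z M n l' := by
  classical
  have hm : ∀ l' ∈ interlacing l, ∀ e, e ∈ fillings n l' ↔ IsFilling n l' e := fun l' hl' e =>
    mem_fillings (strictMono_of_mem_interlacing hl')
  rw [fillingSum, fillings, sum_biUnion, mul_sum, mul_sum]
  · refine sum_congr rfl fun l' hl' => ?_
    rw [sum_image, fillingSum, mul_sum, mul_sum]
    · refine sum_congr rfl fun e he => ?_
      have h := (hm l' hl' e).1 he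
      rw [← mul_assoc, ← mul_assoc, ← pow_add, ← pow_add, fillingNorm_lift h hl' hl hM,
        fillingTop_lift h hl']
    · intro e he e' he' hee
      rw [← ((hm l' hl' e).1 he).lift_sub_one hl', ← ((hm l' hl' e').1 he').lift_sub_one hl']
      simp only [hee]
  · intro l₁ h₁ l₂ h₂ hne
    refine disjoint_left.2 fun e he₁ he₂ => hne ?_
    obtain ⟨e₁, hf₁, rfl⟩ := mem_image.1 he₁
    obtain ⟨e₂, hf₂, hee⟩ := mem_image.1 he₂
    replace hf₁ := (hm l₁ h₁ e₁).1 hf₁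
    replace hf₂ := (hm l₂ h₂ e₂).1 hf₂
    have : e₂ = e₁ := by
      rw [← hf₁.lift_sub_one h₁, ← hf₂.lift_sub_one h₂]
      simp only [hee]
    subst this
    exact hf₁.shape_unique hf₂ (strictMono_of_mem_interlacing h₁).val_le_apply
      (strictMono_of_mem_interlacing h₂).val_le_apply

end

/-- The bialternant formula for the generating function of the fillings of a given shape. -/
theorem exists_det_eq_fillingSum {K : Type*} [Field K] {q : K} (hq : q ≠ 0)
    (hq' : ∀ m, q ^ (m + 1) ≠ 1) (M n : ℕ) :
    ∃ C : K, C ≠ 0 ∧ ∀ (z : K) (l : Fin (n + 1) → ℕ), StrictMono l → (∀ j, l j ≤ M) →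
      Matrix.det (Matrix.of fun j i =>
        (Fin.snoc (fun i : Fin n => q ^ ((i : ℕ) + 1)) (z * q ^ (n + 1)) : Fin (n + 1) → K) i ^ l j) =
      C * (∏ m ∈ range n, (z * q ^ (m + 1) - 1)) * fillingSum q z M n l := by
  induction n with
  | zero =>
    refine ⟨1, one_ne_zero, fun z l _ hM => ?_⟩
    rw [fillingSum_zero _ _ _ (hM 0)]
    simp [Matrix.det_unique, Fin.snoc, mul_comm]
  | succ n ih =>
    obtain ⟨C, hC, h⟩ := ih
    set T := ∑ j : Fin (n + 2), (j : ℕ)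
    -- These are the z-free factors of the branching rule. The last variable contributes q (z
    -- q^(n+1) - 1), q^T comes from `fillingSum_succ`, and the denominator from
    -- `det_alternant_cons_mul`.
    refine ⟨C * (∏ i : Fin n, (q * q ^ ((i : ℕ) + 1) - q)) * q * q ^ T / q ^ (n + 1), ?_, ?_⟩
    · have : ∏ i : Fin n, (q * q ^ ((i : ℕ) + 1) - q) ≠ 0 := prod_ne_zero_iff.2 fun i _ => by
        rw [show q * q ^ ((i : ℕ) + 1) - q = q * (q ^ ((i : ℕ) + 1) - 1) by ring]
        exact mul_ne_zero hq (sub_ne_zero.2 (hq' _))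
      simp [hC, hq, this]
    · intro z l hl hM
      set x : Fin (n + 1) → K :=
        Fin.snoc (fun i : Fin n => q ^ ((i : ℕ) + 1)) (z * q ^ (n + 1)) with hx
      -- The new variables are q followed by q times the old ones, so the branching rule leads back
      -- to the induction hypothesis.
      have e1 : (Fin.snoc (fun i : Fin (n + 1) => q ^ ((i : ℕ) + 1)) (z * q ^ (n + 1 + 1)) :
          Fin (n + 2) → K) = Fin.cons q fun i => q * x i := by
        funext i
        induction i using Fin.cases with
        | zero =>
          rw [Fin.cons_zero, ← Fin.castSucc_zero, Fin.snoc_castSucc]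
          simp
        | succ i =>
          rw [Fin.cons_succ]
          induction i using Fin.lastCases with
          | last => rw [Fin.succ_last, Fin.snoc_last, hx, Fin.snoc_last]; ring
          | cast i =>
            rw [Fin.succ_castSucc, Fin.snoc_castSucc, hx, Fin.snoc_castSucc, Fin.val_succ]
            ring
      have e2 := det_alternant_cons_mul x q hl.monotone
      rw [e1]
      have e3 : ∑ l' ∈ interlacing l, Matrix.det (Matrix.of fun j i => x i ^ l' j) =
          C * (∏ m ∈ range n, (z * q ^ (m + 1) - 1)) *
            ∑ l' ∈ interlacing l, fillingSum q z M n l' := by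
        rw [mul_sum]
        refine sum_congr rfl fun l' hl' => h z l' (strictMono_of_mem_interlacing hl') fun j => ?_
        exact ((mem_interlacing.1 hl' j).2.trans_le (hM _)).le
      have e4 := fillingSum_succ q z M hl hM
      change _ = _ * _ * ∑ l' ∈ interlacing l, _ at e2
      rw [e3, Fin.prod_univ_castSucc] at e2
      simp only [hx, Fin.snoc_castSucc, Fin.snoc_last] at e2
      refine mul_left_cancel₀ (pow_ne_zero (n + 1) hq) (e2.trans ?_)
      rw [prod_range_succ]
      have e5 : q ^ (n + 1) * (C * (∏ i : Fin n, (q * q ^ ((i : ℕ) + 1) - q)) * q * q ^ T /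
          q ^ (n + 1) * ((∏ m ∈ range n, (z * q ^ (m + 1) - 1)) * (z * q ^ (n + 1) - 1)) *
          fillingSum q z M (n + 1) l) =
          C * (∏ i : Fin n, (q * q ^ ((i : ℕ) + 1) - q)) * q *
          ((∏ m ∈ range n, (z * q ^ (m + 1) - 1)) * (z * q ^ (n + 1) - 1)) *
          (q ^ T * fillingSum q z M (n + 1) l) := by
        field_simp
      rw [e5, e4]
      ring

/-! ### Fillings with bounded rows -/

/-- All fillings whose top row has length at most `c`. -/
noncomputable def boundedFillings (p c : ℕ) : Finset (Fin (p + 1) → ℕ → ℕ) :=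
  open Classical in (strictMonoBelow (p + 1) (c + p + 1)).biUnion (fillings p)

theorem mem_boundedFillings {p c : ℕ} {e : Fin (p + 1) → ℕ → ℕ} :
    e ∈ boundedFillings p c ↔
      ∃ l, (StrictMono l ∧ ∀ j, l j < c + p + 1) ∧ IsFilling p l e := by
  simp only [boundedFillings, mem_biUnion, mem_strictMonoBelow]
  exact exists_congr fun l => and_congr_right fun h => mem_fillings h.1

theorem sum_boundedFillings {M : Type*} [AddCommMonoid M] (p c : ℕ)
    (f : (Fin (p + 1) → ℕ → ℕ) → M) :
    ∑ e ∈ boundedFillings p c, f e =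
      ∑ l ∈ strictMonoBelow (p + 1) (c + p + 1), ∑ e ∈ fillings p l, f e := by
  classical
  rw [boundedFillings, sum_biUnion]
  intro l₁ h₁ l₂ h₂ hne
  refine disjoint_left.2 fun e he₁ he₂ => hne ?_
  have h₁ := (mem_strictMonoBelow.1 h₁).1
  have h₂ := (mem_strictMonoBelow.1 h₂).1
  exact ((mem_fillings h₁).1 he₁).shape_unique ((mem_fillings h₂).1 he₂) h₁.val_le_apply
    h₂.val_le_apply

theorem fillingTop_le {p c : ℕ} {e : Fin (p + 1) → ℕ → ℕ} (he : e ∈ boundedFillings p c) (M : ℕ) :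
    fillingTop M e ≤ c := by
  obtain ⟨l, ⟨-, hl⟩, h⟩ := mem_boundedFillings.1 he
  rw [fillingTop, ← card_range c]
  refine card_le_card fun t ht => ?_
  have h1 := (h.supp (Fin.last p) t).1 (by rw [(mem_filter.1 ht).2]; omega)
  have h2 := hl (Fin.last p)
  rw [Fin.val_last] at h1
  rw [mem_range]
  omega

/-! ### Strict plane partitions as bounded fillings -/

namespace StrictPlanePartition

/-- The strict plane partitions with parts in `{1, …, n}` and at most `c` columns. -/
def bounded (n c : ℕ) : Set StrictPlanePartition :=
  {π | π.PartsIn n ∧ π.numCols ≤ c}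

theorem entry_ne_zero {π : StrictPlanePartition} {n : ℕ} (h : π.PartsIn n) {i j : ℕ} :
    π.entry i j ≠ 0 ↔ (i, j) ∈ π.shape := by
  constructor
  · intro h0
    by_contra h1
    exact h0 (π.zeros h1)
  · intro h1
    have := (h (i, j) h1).1
    simp only at this
    omega

/-- Strict descent down a column yields the bound `IsFilling.le` and limits the number of rows to n.
-/
theorem entry_add_le {π : StrictPlanePartition} {n : ℕ} (h : π.PartsIn n) {i j : ℕ}
    (hij : (i, j) ∈ π.shape) : π.entry i j + i ≤ n := by
  induction i with
  | zero => exact (h (0, j) hij).2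
  | succ i ih =>
    have h1 := ih (π.shape.up_left_mem (Nat.le_add_right i 1) le_rfl hij)
    have h2 := π.col_strict (Nat.lt_add_one i) hij
    omega

theorem lt_of_mem_shape {π : StrictPlanePartition} {n : ℕ} (h : π.PartsIn n) {i j : ℕ}
    (hij : (i, j) ∈ π.shape) : i < n := by
  have h1 := entry_add_le h hij
  have h2 := (h (i, j) hij).1
  simp only at h2
  omega

/-- The rows of a strict plane partition, from row `p` to row `0`. -/
def toFilling (p : ℕ) (π : StrictPlanePartition) : Fin (p + 1) → ℕ → ℕ :=
  fun j t => π.entry (p - j) t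

theorem toFilling_mem {p c : ℕ} {π : StrictPlanePartition} (h : π ∈ bounded (p + 1) c) :
    π.toFilling p ∈ boundedFillings p c := by
  obtain ⟨h, hc⟩ := h
  refine mem_boundedFillings.2 ⟨fun j => π.shape.rowLen (p - j) + j, ⟨?_, ?_⟩, ⟨?_, ?_, ?_, ?_⟩⟩
  · intro i j hij
    have := π.shape.rowLen_anti (p - j) (p - i) (by omega)
    rw [Fin.lt_def] at hij
    simp only
    omega
  · intro j
    have h1 := π.shape.rowLen_anti 0 (p - j) (Nat.zero_le _)
    rw [numCols] at hc
    simp only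
    omega
  · intro j t
    rw [toFilling, entry_ne_zero h, YoungDiagram.mem_iff_lt_rowLen]
    omega
  · intro j t
    by_cases h1 : (p - (j : ℕ), t + 1) ∈ π.shape
    · exact π.row_weak (Nat.lt_succ_self t) h1
    · rw [toFilling, π.zeros h1]
      exact Nat.zero_le _
  · intro i j t hij h0
    rw [Fin.lt_def] at hij
    exact π.col_strict (by omega) ((entry_ne_zero h).1 h0)
  · intro j t
    by_cases h1 : (p - (j : ℕ), t) ∈ π.shape
    · have := entry_add_le h h1
      rw [toFilling]
      omega
    · rw [toFilling, π.zeros h1]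
      exact Nat.zero_le _

theorem toFilling_injOn (p c : ℕ) : Set.InjOn (toFilling p) (bounded (p + 1) c) := by
  intro π hπ π' hπ' heq
  have hrow : ∀ i j, π.entry i j = π'.entry i j := by
    intro i j
    by_cases hi : i < p + 1
    · have := congrFun (congrFun heq ⟨p - i, by omega⟩) j
      simpa [toFilling, Nat.sub_sub_self (Nat.lt_succ_iff.1 hi)] using this
    · rw [π.zeros fun h => hi (lt_of_mem_shape hπ.1 h),
        π'.zeros fun h => hi (lt_of_mem_shape hπ'.1 h)]
  refine StrictPlanePartition.ext ?_ (funext fun i => funext fun j => hrow i j)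
  refine YoungDiagram.ext (Finset.ext fun x => ?_)
  rw [YoungDiagram.mem_cells, YoungDiagram.mem_cells]
  obtain ⟨i, j⟩ := x
  rw [← entry_ne_zero hπ.1, ← entry_ne_zero hπ'.1, hrow]

theorem exists_toFilling_eq {p c : ℕ} {e : Fin (p + 1) → ℕ → ℕ} (he : e ∈ boundedFillings p c) :
    ∃ π ∈ bounded (p + 1) c, π.toFilling p = e := by
  obtain ⟨l, ⟨hl, hN⟩, h⟩ := mem_boundedFillings.1 he
  set E : ℕ → ℕ → ℕ := fun i t => if h : i ≤ p then e ⟨p - i, by omega⟩ t else 0 with hE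
  have hEne : ∀ {i t}, E i t ≠ 0 → ∃ hi : i ≤ p, e ⟨p - i, by omega⟩ t ≠ 0 := by
    intro i t h0
    by_cases hi : i ≤ p
    · exact ⟨hi, by simpa [hE, hi] using h0⟩
    · simp [hE, hi] at h0
  have hrow : ∀ {i t₁ t₂}, t₁ ≤ t₂ → E i t₂ ≤ E i t₁ := by
    intro i t₁ t₂ ht
    by_cases hi : i ≤ p
    · simp only [hE, hi, dite_true]
      exact antitone_nat_of_succ_le (fun t => h.row _ t) ht
    · simp [hE, hi]
  have hcol : ∀ {i₁ i₂ t}, i₁ < i₂ → E i₂ t ≠ 0 → E i₂ t < E i₁ t := by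
    intro i₁ i₂ t hi h0
    obtain ⟨h2, h3⟩ := hEne h0
    have h1 : i₁ ≤ p := by omega
    simp only [hE, h1, h2, dite_true]
    exact h.col _ _ t (by rw [Fin.lt_def]; simp only; omega) h3
  have hlen : ∀ {i t}, E i t ≠ 0 → t < c ∧ i < p + 1 := by
    intro i t h0
    obtain ⟨hi, h1⟩ := hEne h0
    refine ⟨?_, by omega⟩
    have h2 : E 0 t ≠ 0 := by
      rcases Nat.eq_zero_or_pos i with rfl | hi
      · exact h0
      · have := hcol hi h0; omega
    obtain ⟨h3, h4⟩ := hEne h2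
    have h5 := (h.supp _ _).1 h4
    have h6 := hN ⟨p - 0, by omega⟩
    simp only at h5 h6
    omega
  set Y : YoungDiagram :=
    { cells := (range (p + 1) ×ˢ range c).filter fun x => E x.1 x.2 ≠ 0
      isLowerSet := by
        rintro ⟨i, t⟩ ⟨i', t'⟩ ⟨hi, ht⟩ hx
        simp only at hi ht
        simp only [coe_filter, mem_product, mem_range, Set.mem_ofPred_eq] at hx ⊢
        have h0 : E i' t ≠ 0 := by
          rcases hi.eq_or_lt with rfl | hi
          · exact hx.2
          · have := hcol hi hx.2; omega
        have h1 := hrow (i := i') ht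
        exact ⟨⟨by omega, by omega⟩, by omega⟩ } with hY
  have hmem : ∀ {i t}, (i, t) ∈ Y ↔ E i t ≠ 0 := by
    intro i t
    rw [← YoungDiagram.mem_cells]
    simp only [hY, mem_filter, mem_product, mem_range]
    exact ⟨fun h => h.2, fun h => ⟨⟨(hlen h).2, (hlen h).1⟩, h⟩⟩
  refine ⟨⟨Y, E, fun ht _ => hrow ht.le, fun hi hx => hcol hi (hmem.1 hx), fun hx => ?_⟩,
    ⟨?_, ?_⟩, ?_⟩
  · by_contra h0
    exact hx (hmem.2 h0)
  · rintro ⟨i, t⟩ hx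
    have h0 := hmem.1 ((YoungDiagram.mem_cells _).1 hx)
    refine ⟨Nat.one_le_iff_ne_zero.2 h0, ?_⟩
    obtain ⟨hi, -⟩ := hEne h0
    simp only [hE, hi, dite_true]
    refine (h.le _ _).trans ?_
    simp only
    omega
  · rw [numCols]
    by_contra h1
    exact absurd (hlen (hmem.1 (YoungDiagram.mem_iff_lt_rowLen.2 (not_le.1 h1)))).1 (lt_irrefl c)
  · funext j t
    have hj : p - (j : ℕ) ≤ p := Nat.sub_le _ _
    simp only [toFilling, hE, hj, dite_true]
    congr 2
    exact Nat.sub_sub_self (Nat.lt_succ_iff.1 j.2)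

theorem bijOn_toFilling (p c : ℕ) :
    Set.BijOn (toFilling p) (bounded (p + 1) c) (boundedFillings p c) :=
  ⟨fun _ h => toFilling_mem h, toFilling_injOn p c, fun _ h => exists_toFilling_eq h⟩

theorem col_lt {π : StrictPlanePartition} {n c i j : ℕ} (h : π ∈ bounded n c)
    (hij : (i, j) ∈ π.shape) : j < c :=
  (YoungDiagram.mem_iff_lt_rowLen.1 (π.shape.up_left_mem (Nat.zero_le i) le_rfl hij)).trans_le h.2

theorem norm_eq {p c : ℕ} {π : StrictPlanePartition} (h : π ∈ bounded (p + 1) c) {M : ℕ}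
    (hM : c ≤ M) : π.norm = fillingNorm M (π.toFilling p) := by
  have hsub : π.shape.cells ⊆ range (p + 1) ×ˢ range M := by
    rintro ⟨i, j⟩ hx
    rw [mem_product, mem_range, mem_range]
    exact ⟨lt_of_mem_shape h.1 hx, (col_lt h hx).trans_le hM⟩
  rw [norm, sum_subset hsub fun x _ hx => π.zeros hx, sum_product, fillingNorm,
    ← sum_range_reflect, ← Fin.sum_univ_eq_sum_range
      (fun j => ∑ t ∈ range M, π.entry (p + 1 - 1 - j) t)]
  rfl

theorem numParts_eq {p c : ℕ} {π : StrictPlanePartition} (h : π ∈ bounded (p + 1) c) {M : ℕ}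
    (hM : c ≤ M) : π.numParts (p + 1) = fillingTop M (π.toFilling p) := by
  rw [numParts, fillingTop]
  refine card_nbij' (fun x => x.2) (fun t => (0, t)) ?_ ?_ ?_ ?_
  · rintro ⟨i, j⟩ hx
    simp only [coe_filter, Set.mem_ofPred_eq] at hx
    have h1 := entry_add_le h.1 hx.1
    have hi : i = 0 := by omega
    subst hi
    refine mem_coe.2 (mem_filter.2 ⟨mem_range.2 ((col_lt h hx.1).trans_le hM), ?_⟩)
    simpa [toFilling] using hx.2
  · intro t ht
    simp only [coe_filter, Set.mem_ofPred_eq, mem_range, toFilling, Fin.val_last,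
      Nat.sub_self] at ht ⊢
    exact ⟨(entry_ne_zero h.1).1 (by omega), ht.2⟩
  · rintro ⟨i, j⟩ hx
    simp only [coe_filter, Set.mem_ofPred_eq] at hx
    have h1 := entry_add_le h.1 hx.1
    have hi : i = 0 := by omega
    subst hi
    rfl
  · intro t _
    rfl

theorem finite_bounded (p c : ℕ) : (bounded (p + 1) c).Finite :=
  (bijOn_toFilling p c).finite_iff_finite.2 (boundedFillings p c).finite_toSet

theorem refined_subset_bounded (n c k : ℕ) : refined n c k ⊆ bounded n c :=
  fun _ h => ⟨h.1, h.2.1⟩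

theorem refined_zero_eq_bounded (n c : ℕ) : refined (n + 1) c 0 = bounded n c := by
  ext π
  simp only [refined, bounded, Set.mem_ofPred_eq, numParts, card_eq_zero, filter_eq_empty_iff]
  constructor
  · rintro ⟨h1, h2, h3⟩
    refine ⟨fun x hx => ?_, h2⟩
    have := h1 x hx
    have := h3 hx
    omega
  · rintro ⟨h1, h2⟩
    refine ⟨fun x hx => ?_, h2, fun x hx => ?_⟩
    · have := h1 x hx
      omega
    · have := h1 x hx
      omega

end StrictPlanePartition

/-! ### Counting by the number of largest parts -/

section

open StrictPlanePartition

variable {R : Type*} [CommRing R] (q : R)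

/-- The generating function of the bounded fillings with exactly `k` largest possible entries. -/
noncomputable def refinedSum (p c k : ℕ) : R :=
  ∑ e ∈ boundedFillings p c with fillingTop (c + p + 1) e = k, q ^ fillingNorm (c + p + 1) e

theorem finsum_refined (p c k : ℕ) :
    ∑ᶠ π ∈ refined (p + 1) c k, q ^ π.norm = refinedSum q p c k := by
  rw [refinedSum, ← finsum_mem_coe_finset]
  refine finsum_mem_eq_of_bijOn (toFilling p) ⟨?_, ?_, ?_⟩ ?_
  · intro π hπ
    have hb := refined_subset_bounded _ _ _ hπ
    rw [coe_filter]
    exact ⟨toFilling_mem hb, by rw [← numParts_eq hb (by omega)]; exact hπ.2.2⟩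
  · exact (toFilling_injOn p c).mono (refined_subset_bounded _ _ _)
  · intro e he
    rw [coe_filter] at he
    obtain ⟨π, hπ, rfl⟩ := exists_toFilling_eq he.1
    exact ⟨π, ⟨hπ.1, hπ.2, (numParts_eq hπ (by omega)).trans he.2⟩, rfl⟩
  · intro π hπ
    rw [norm_eq (refined_subset_bounded _ _ _ hπ) (M := c + p + 1) (by omega)]

theorem finsum_bounded (p c : ℕ) :
    ∑ᶠ π ∈ bounded (p + 1) c, q ^ π.norm =
      ∑ e ∈ boundedFillings p c, q ^ fillingNorm (c + p + 1) e := by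
  rw [← finsum_mem_coe_finset]
  refine finsum_mem_eq_of_bijOn (toFilling p) (bijOn_toFilling p c) fun π hπ => ?_
  rw [norm_eq hπ (M := c + p + 1) (by omega)]

/-- Having no part equal to p + 2 means having all parts at most p + 1. This recursion fixes the
scalar that the gap argument leaves open. -/
theorem refinedSum_succ_zero (p c : ℕ) :
    refinedSum q (p + 1) c 0 = ∑ k ∈ range (c + 1), refinedSum q p c k := by
  rw [← finsum_refined, refined_zero_eq_bounded, finsum_bounded]
  exact (sum_fiberwise_of_maps_to
    (fun e he => mem_range.2 (Nat.lt_succ_of_le (fillingTop_le he _))) _).symm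

theorem sum_fillingSum (z : R) (p c : ℕ) :
    ∑ l ∈ strictMonoBelow (p + 1) (c + p + 1), fillingSum q z (c + p + 1) p l =
      ∑ k ∈ range (c + 1), refinedSum q p c k * z ^ k := by
  simp only [fillingSum]
  rw [← sum_boundedFillings p c (fun e => q ^ fillingNorm (c + p + 1) e *
    z ^ fillingTop (c + p + 1) e), ← sum_fiberwise_of_maps_to
    (fun e he => mem_range.2 (Nat.lt_succ_of_le (fillingTop_le he (c + p + 1))))]
  refine sum_congr rfl fun k _ => ?_
  rw [refinedSum, sum_mul]
  refine sum_congr rfl fun e he => ?_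
  rw [(mem_filter.1 he).2]

end

/-! ### Polynomials with gaps -/

section SparsePolynomials

open Polynomial

variable {K : Type*} [Field K]

theorem natDegree_C_sub_C_mul_X_le (a b : K) : (C a - C b * X).natDegree ≤ 1 := by
  refine (natDegree_sub_le _ _).trans (max_le ?_ ?_)
  · simp
  · exact (natDegree_C_mul_le _ _).trans natDegree_X_le

theorem natDegree_one_sub_C_mul_X_le (b : K) : (1 - C b * X).natDegree ≤ 1 := by
  simpa only [C_1] using natDegree_C_sub_C_mul_X_le 1 b

/-- A polynomial with at most `n` terms that vanishes at `n` consecutive powers of `r` is zero. -/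
theorem Polynomial.eq_zero_of_eval_pow_eq_zero {r : K} (hr : Function.Injective fun m : ℕ => r ^ m)
    (hr0 : r ≠ 0) {H : K[X]} {n : ℕ} (hcard : #H.support ≤ n)
    (heval : ∀ i < n, H.eval (r ^ (i + 1)) = 0) : H = 0 := by
  set σ := H.support.equivFin
  set e : Fin #H.support → ℕ := fun s => (σ.symm s : ℕ)
  have he : Function.Injective fun s => r ^ e s :=
    hr.comp (Subtype.val_injective.comp σ.symm.injective)
  have hz : (fun s => H.coeff (e s) * r ^ e s) = 0 := by
    refine Matrix.eq_zero_of_forall_pow_sum_mul_pow_eq_zero he fun i => ?_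
    have h1 := heval i (i.2.trans_le hcard)
    rw [eval_eq_sum, sum_def, ← sum_coe_sort, ← Equiv.sum_comp σ.symm] at h1
    rw [← h1]
    refine sum_congr rfl fun s _ => ?_
    simp only [e]
    ring
  by_contra hH
  obtain ⟨m, hm⟩ := nonempty_support_iff.2 hH
  have h1 := congrFun hz (σ ⟨m, hm⟩)
  simp only [e, Equiv.symm_apply_apply, Pi.zero_apply, mul_eq_zero] at h1
  rcases h1 with h1 | h1
  · exact (mem_support_iff.1 hm) h1
  · exact pow_ne_zero _ hr0 h1

/-- Sequences in the span of finitely many geometric sequences satisfy a linear recurrence. -/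
theorem coeff_prod_mul_sum_geom {ι : Type*} (I : Finset ι) (r a : ι → K) (b : ℕ → K) (T : ℕ)
    (hb : ∀ m < T, b m = ∑ i ∈ I, a i * r i ^ m) {j : ℕ} (h1 : #I ≤ j) (h2 : j < T) :
    ((∏ i ∈ I, (1 - C (r i) * X)) * ∑ m ∈ range T, C (b m) * X ^ m).coeff j = 0 := by
  classical
  have e1 : ∑ m ∈ range T, C (b m) * X ^ m =
      ∑ i ∈ I, C (a i) * ∑ m ∈ range T, (C (r i) * X) ^ m := by
    simp only [mul_sum]
    rw [sum_comm]
    refine sum_congr rfl fun m hm => ?_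
    rw [hb m (mem_range.1 hm), map_sum, sum_mul]
    refine sum_congr rfl fun i _ => ?_
    rw [mul_pow, map_mul, map_pow, mul_assoc]
  rw [e1, mul_sum, finsetSum_coeff]
  refine sum_eq_zero fun i hi => ?_
  -- Each geometric sum telescopes against its own factor, leaving terms only in degrees below #I or
  -- at least T.
  have e2 : (∏ i ∈ I, (1 - C (r i) * X)) * (C (a i) * ∑ m ∈ range T, (C (r i) * X) ^ m) =
      C (a i) * (∏ i ∈ I.erase i, (1 - C (r i) * X)) -
        C (a i * r i ^ T) * (∏ i ∈ I.erase i, (1 - C (r i) * X)) * X ^ T := by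
    rw [← mul_prod_erase I _ hi]
    have := mul_neg_geom_sum (C (r i) * X) T
    rw [map_mul, map_pow]
    linear_combination C (a i) * (∏ i ∈ I.erase i, (1 - C (r i) * X)) * this
  have hdeg : (∏ i ∈ I.erase i, (1 - C (r i) * X)).natDegree < j := by
    refine lt_of_le_of_lt (natDegree_prod_le _ _) (lt_of_le_of_lt (sum_le_card_nsmul _ _ 1 ?_) ?_)
    · intro i _
      exact natDegree_one_sub_C_mul_X_le _
    · rw [card_erase_of_mem hi]
      have := card_pos.2 ⟨i, hi⟩
      simp only [smul_eq_mul, mul_one]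
      omega
  rw [e2, coeff_sub, coeff_C_mul, coeff_eq_zero_of_natDegree_lt hdeg, mul_zero, zero_sub,
    coeff_mul_X_pow', if_neg (by omega), neg_zero]

theorem coeff_sum_C_mul_X_pow (b : ℕ → K) (T j : ℕ) :
    (∑ m ∈ range T, C (b m) * X ^ m).coeff j = if j < T then b j else 0 := by
  simp [coeff_C_mul, coeff_X_pow]

variable {q : K} (hq : q ≠ 0) (hq' : ∀ m, q ^ (m + 1) ≠ 1)

include hq hq' in
theorem pow_injective_of_ne_one : Function.Injective fun m : ℕ => q ^ m := by
  refine Function.Injective.of_lt_imp_ne fun a b hab h => ?_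
  obtain ⟨d, rfl⟩ := Nat.exists_eq_add_of_lt hab
  simp only [add_assoc, pow_add q a] at h
  exact hq' d (mul_left_cancel₀ (pow_ne_zero a hq) (by rw [mul_one, ← h]))

include hq hq' in
/-- A polynomial `G` of degree at most `c`, such that `∏ (1 - q^i X) G` has a long gap, is
determined by its constant term. -/
theorem eq_zero_of_gap {p c : ℕ} {G : K[X]} (hdeg : G.natDegree ≤ c) (h0 : G.coeff 0 = 0)
    (hgap : ∀ j, p + 1 ≤ j → j < c + p + 1 →
      ((∏ i ∈ range (2 * p + 1), (1 - C (q ^ (i + 1)) * X)) * G).coeff j = 0) : G = 0 := by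
  set P : K[X] := ∏ i ∈ range (2 * p + 1), (1 - C (q ^ (i + 1)) * X)
  have hP : P ≠ 0 := prod_ne_zero_iff.2 fun i _ h => by
    simpa using congrArg (eval 0) h
  have hPdeg : P.natDegree ≤ 2 * p + 1 := by
    refine (natDegree_prod_le _ _).trans ((sum_le_card_nsmul _ _ 1 fun i _ => ?_).trans (by simp))
    exact natDegree_one_sub_C_mul_X_le _
  -- Without the constant term, p + (p + 1) exponents remain, as many as the known zeros q⁻¹, ...,
  -- q^(-(2p+1)) of P.
  have hsupp : (P * G).support ⊆ Ico 1 (p + 1) ∪ Ico (c + p + 1) (c + 2 * p + 2) := by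
    intro j hj
    have hne := mem_support_iff.1 hj
    have h1 : j ≤ c + 2 * p + 1 := (le_natDegree_of_ne_zero hne).trans
      (natDegree_mul_le.trans (by omega))
    have h2 : j ≠ 0 := by
      rintro rfl
      exact hne (by rw [mul_coeff_zero, h0, mul_zero])
    have h3 : ¬ (p + 1 ≤ j ∧ j < c + p + 1) := fun h => hne (hgap j h.1 h.2)
    simp only [mem_union, mem_Ico]
    omega
  have hcard : #(P * G).support ≤ 2 * p + 1 := by
    refine (card_le_card hsupp).trans ((card_union_le _ _).trans ?_)
    simp only [Nat.card_Ico]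
    omega
  have hinj : Function.Injective fun m : ℕ => q⁻¹ ^ m := fun a b h => by
    simp only [inv_pow, inv_inj] at h
    exact pow_injective_of_ne_one hq hq' h
  have hz : P * G = 0 :=
    eq_zero_of_eval_pow_eq_zero hinj (inv_ne_zero hq) hcard fun i hi => by
      rw [eval_mul, eval_prod, prod_eq_zero (mem_range.2 hi), zero_mul]
      simp [hq]
  exact (mul_eq_zero.1 hz).resolve_left hP

/-! ### The explicit weight and proportionality -/

/-- The product `(1 - q^a) (1 - q^(a+1)) ⋯ (1 - q^(a+m-1))`. -/
def qPoch (q : K) (a m : ℕ) : K := ∏ i ∈ range m, (1 - q ^ (a + i))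

theorem qPoch_add (a m n : ℕ) : qPoch q a (m + n) = qPoch q a m * qPoch q (a + m) n := by
  simp only [qPoch, prod_range_add, add_assoc]

include hq' in
theorem qPoch_ne_zero (a m : ℕ) : qPoch q (a + 1) m ≠ 0 :=
  prod_ne_zero_iff.2 fun i _ => sub_ne_zero.2 (by
    rw [add_right_comm]; exact (hq' _).symm)

/-- The dependence of the generating function on the number `k` of largest parts, up to a factor
that does not depend on `k`. -/
def refinedWeight (q : K) (p c k : ℕ) : K :=
  q ^ (k * (p + 1)) * qPoch q (k + 1) p * qPoch q (c - k + 1) p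

include hq in
-- Up to a scalar the weight is q^t Q(q^t) at t = p + k with deg Q ≤ 2p, a combination of the
-- sequences q^t, ..., q^((2p+1)t). The zeros of Q make this expression vanish for p values of t on
-- either side of the range, so the sum extends to c + 2p + 1 terms.
theorem gap_refinedWeight (p c : ℕ) {j : ℕ} (h1 : p + 1 ≤ j) (h2 : j < c + p + 1) :
    ((∏ i ∈ range (2 * p + 1), (1 - C (q ^ (i + 1)) * X)) *
      ∑ k ∈ range (c + 1), C (refinedWeight q p c k) * X ^ k).coeff j = 0 := by
  set Q : K[X] := (∏ i ∈ range p, (C (q ^ p) - C (q ^ (i + 1)) * X)) *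
    ∏ i ∈ range p, (X - C (q ^ (c + 1 + i + p)))
  have hQdeg : Q.natDegree < 2 * p + 1 := by
    refine Nat.lt_succ_of_le (natDegree_mul_le.trans ?_)
    rw [two_mul]
    refine add_le_add ?_ ?_
    · refine (natDegree_prod_le _ _).trans ((sum_le_card_nsmul _ _ 1 fun i _ => ?_).trans (by simp))
      exact natDegree_C_sub_C_mul_X_le _ _
    · refine (natDegree_prod_le _ _).trans ((sum_le_card_nsmul _ _ 1 fun i _ => ?_).trans (by simp))
      exact natDegree_X_sub_C_le _
  set b : ℕ → K := fun t => q ^ t * Q.eval (q ^ t)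
  have hb : ∀ m < c + 2 * p + 1, b m = ∑ i ∈ range (2 * p + 1), Q.coeff i * (q ^ (i + 1)) ^ m := by
    intro m _
    simp only [b]
    rw [eval_eq_sum_range' hQdeg, mul_sum]
    refine sum_congr rfl fun i _ => ?_
    rw [← pow_mul, ← pow_mul]
    ring
  have hgap := coeff_prod_mul_sum_geom (range (2 * p + 1)) (fun i => q ^ (i + 1)) Q.coeff b
    (c + 2 * p + 1) hb (j := j + p) (by simp; omega) (by omega)
  have hblow : ∀ t, t < p → b t = 0 := by
    intro t ht
    simp only [b, Q, eval_mul, eval_prod]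
    rw [prod_eq_zero (i := p - 1 - t) (mem_range.2 (by omega)), zero_mul, mul_zero]
    simp only [eval_sub, eval_mul, eval_C, eval_X, ← pow_add]
    rw [show p - 1 - t + 1 + t = p by omega, sub_self]
  have hbhigh : ∀ t, c + 1 ≤ t → t < c + 1 + p → b (p + t) = 0 := by
    intro t ht ht'
    simp only [b, Q, eval_mul, eval_prod]
    rw [prod_eq_zero (s := range p) (f := fun i => eval _ (X - C (q ^ (c + 1 + i + p))))
      (i := t - (c + 1)) (mem_range.2 (by omega)), mul_zero, mul_zero]
    simp only [eval_sub, eval_C, eval_X]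
    rw [show c + 1 + (t - (c + 1)) + p = p + t by omega, sub_self]
  have hconst : ∀ y : K, ∏ _i ∈ range p, y = y ^ p := fun y => by simp
  have hbmid : ∀ k ∈ range (c + 1), b (p + k) = q ^ (p + p * p + p * p) * refinedWeight q p c k := by
    intro k hk
    rw [mem_range] at hk
    simp only [b, Q, eval_mul, eval_prod, eval_sub, eval_C, eval_X, refinedWeight, qPoch]
    have e1 : ∏ i ∈ range p, (q ^ p - q ^ (i + 1) * q ^ (p + k)) =
        q ^ (p * p) * ∏ i ∈ range p, (1 - q ^ (k + 1 + i)) := by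
      rw [pow_mul, ← hconst (q ^ p), ← prod_mul_distrib]
      refine prod_congr rfl fun i _ => ?_
      rw [show k + 1 + i = i + 1 + k by ring]
      simp only [pow_add]; ring
    have e2 : ∏ i ∈ range p, (q ^ (p + k) - q ^ (c + 1 + i + p)) =
        q ^ ((p + k) * p) * ∏ i ∈ range p, (1 - q ^ (c - k + 1 + i)) := by
      rw [pow_mul, ← hconst (q ^ _), ← prod_mul_distrib]
      refine prod_congr rfl fun i _ => ?_
      rw [mul_sub, ← pow_add, mul_one]
      congr 2
      omega
    rw [e1, e2]
    ring
  have e3 : ∑ m ∈ range (c + 2 * p + 1), C (b m) * X ^ m =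
      C (q ^ (p + p * p + p * p)) *
        (∑ k ∈ range (c + 1), C (refinedWeight q p c k) * X ^ k) * X ^ p := by
    rw [show c + 2 * p + 1 = p + ((c + 1) + p) by ring, sum_range_add,
      sum_range_add (fun m => C (b (p + m)) * X ^ (p + m)),
      sum_eq_zero fun t ht => by rw [hblow t (mem_range.1 ht), C_0, zero_mul], zero_add]
    rw [sum_eq_zero (s := range p) fun t ht => by
      rw [hbhigh (c + 1 + t) (by omega) (by have := mem_range.1 ht; omega), C_0, zero_mul],
      add_zero, mul_sum, sum_mul]
    refine sum_congr rfl fun k hk => ?_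
    rw [hbmid k hk, C_mul, pow_add]
    ring
  rw [e3, ← mul_assoc, coeff_mul_X_pow, mul_left_comm, coeff_C_mul] at hgap
  exact (mul_eq_zero.1 hgap).resolve_left (pow_ne_zero _ hq)

include hq hq' in
-- The first p factors come from the alternant formula. The last p + 1 annihilate the coefficients
-- of the alternant sum at w = z q^(p+1), which combine the geometric sequences of ratios q^(p+1),
-- ..., q^(2p+1).
theorem gap_refinedSum (p c : ℕ) {j : ℕ} (h1 : p + 1 ≤ j) (h2 : j < c + p + 1) :
    ((∏ i ∈ range (2 * p + 1), (1 - C (q ^ (i + 1)) * X)) *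
      ∑ k ∈ range (c + 1), C (refinedSum q p c k) * X ^ k).coeff j = 0 := by
  have : Infinite K := Infinite.of_injective _ (pow_injective_of_ne_one hq hq')
  obtain ⟨g, a, hg, hrec⟩ := exists_sum_alternants (fun i : Fin p => q ^ ((i : ℕ) + 1)) (c + p + 1)
  obtain ⟨D, hD, hdet⟩ := exists_det_eq_fillingSum hq hq' (c + p + 1) p
  set G : K[X] := ∑ k ∈ range (c + 1), C (refinedSum q p c k) * X ^ k
  set b : ℕ → K := fun m => g m * (q ^ (p + 1)) ^ m
  have key : C D * (∏ m ∈ range p, (C (q ^ (m + 1)) * X - 1)) * G =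
      ∑ m ∈ range (c + p + 1), C (b m) * X ^ m := by
    refine Polynomial.funext fun z => ?_
    have e1 := hg (z * q ^ (p + 1))
    rw [sum_congr rfl fun l hl => hdet z l (mem_strictMonoBelow.1 hl).1
      fun j => ((mem_strictMonoBelow.1 hl).2 j).le, ← mul_sum, sum_fillingSum] at e1
    simp only [eval_mul, eval_C, eval_prod, eval_sub, eval_X, eval_one, eval_finsetSum, eval_pow,
      G, b]
    simp only [mul_pow, mul_comm (q ^ (_ + 1)) z] at e1 ⊢
    rw [e1]
    refine sum_congr rfl fun m _ => ?_
    ring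
  obtain ⟨a', ha'⟩ : ∃ a' : Fin (p + 1) → K, ∀ m < c + p + 1,
      g m = ∑ i, a' i * (q ^ (i : ℕ)) ^ m := by
    -- Summing the differences of g divides by (ratio - 1); the constant of summation contributes
    -- the ratio 1.
    set d : Fin p → K := fun i => a i / (q ^ ((i : ℕ) + 1) - 1)
    refine ⟨Fin.cons (g 0 - ∑ i, d i) d, fun m hm => ?_⟩
    induction m with
    | zero => simp [Fin.sum_univ_succ]
    | succ m ih =>
      rw [← sub_add_cancel (g (m + 1)) (g m), hrec m hm, ih (by omega), Fin.sum_univ_succ,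
        Fin.sum_univ_succ]
      simp only [Fin.cons_zero, Fin.cons_succ, Fin.val_zero, pow_zero, one_pow, Fin.val_succ]
      rw [add_left_comm, ← sum_add_distrib]
      congr 1
      refine sum_congr rfl fun i _ => ?_
      have : q ^ ((i : ℕ) + 1) - 1 ≠ 0 := sub_ne_zero.2 (hq' _)
      simp only [d]
      field_simp
      ring
  have hgap := coeff_prod_mul_sum_geom univ (fun i : Fin (p + 1) => q ^ (p + (i : ℕ) + 1)) a' b
    (c + p + 1) (fun m hm => by
      simp only [b]
      rw [ha' m hm, sum_mul]
      refine sum_congr rfl fun i _ => ?_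
      rw [mul_assoc, ← mul_pow, ← pow_add]
      congr 3
      ring) (j := j) (by simpa using h1) h2
  rw [← key, Fin.prod_univ_eq_prod_range (fun i => (1 - C (q ^ (p + i + 1)) * X : K[X]))] at hgap
  rw [show 2 * p + 1 = p + (p + 1) by ring, prod_range_add]
  have e2 : ∏ m ∈ range p, (C (q ^ (m + 1)) * X - 1 : K[X]) =
      C ((-1) ^ p) * ∏ m ∈ range p, (1 - C (q ^ (m + 1)) * X) := by
    nth_rewrite 2 [← card_range p]
    rw [map_pow, ← prod_const, ← prod_mul_distrib]
    refine prod_congr rfl fun i _ => ?_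
    simp
  rw [e2] at hgap
  have e3 : ∀ A B : K[X], A * (C D * (C ((-1) ^ p) * B) * G) = C (D * (-1) ^ p) * (B * A * G) :=
    fun A B => by rw [C_mul]; ring
  rw [e3, coeff_C_mul] at hgap
  exact (mul_eq_zero.1 hgap).resolve_left (mul_ne_zero hD (pow_ne_zero _ (by simp)))

include hq hq' in
-- Cross-multiplying by the constant terms gives a difference with zero constant term and the same
-- gap, to which `eq_zero_of_gap` applies.
theorem refinedSum_mul_refinedWeight {p c k : ℕ} (hk : k ≤ c) :
    refinedWeight q p c 0 * refinedSum q p c k = refinedSum q p c 0 * refinedWeight q p c k := by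
  set G₁ : K[X] := ∑ k ∈ range (c + 1), C (refinedSum q p c k) * X ^ k with hG₁
  set G₂ : K[X] := ∑ k ∈ range (c + 1), C (refinedWeight q p c k) * X ^ k with hG₂
  have hG : C (refinedWeight q p c 0) * G₁ - C (refinedSum q p c 0) * G₂ = 0 := by
    refine eq_zero_of_gap hq hq' (p := p) (c := c) ?_ ?_ ?_
    · refine natDegree_le_iff_coeff_eq_zero.2 fun N hN => ?_
      rw [coeff_sub, coeff_C_mul, coeff_C_mul, coeff_sum_C_mul_X_pow, coeff_sum_C_mul_X_pow,
        if_neg (by omega), if_neg (by omega)]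
      ring
    · rw [coeff_sub, coeff_C_mul, coeff_C_mul, coeff_sum_C_mul_X_pow, coeff_sum_C_mul_X_pow,
        if_pos (by omega), if_pos (by omega)]
      ring
    · intro j h1 h2
      rw [mul_sub, mul_left_comm, mul_left_comm _ (C (refinedSum q p c 0)), coeff_sub, coeff_C_mul,
        coeff_C_mul, gap_refinedSum hq hq' p c h1 h2, gap_refinedWeight hq p c h1 h2]
      ring
  have h1 := congrArg (fun P => coeff P k) hG
  simp only [coeff_sub, coeff_C_mul, hG₁, hG₂, coeff_sum_C_mul_X_pow, coeff_zero,
    if_pos (Nat.lt_succ_of_le hk)] at h1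
  exact sub_eq_zero.1 h1

/-! ### Gaussian binomials and q-Vandermonde -/

/-- The `q`-binomial coefficient of `a + k` over `a`. -/
def gaussBinom (q : K) (a k : ℕ) : K := qPoch q (k + 1) a / qPoch q 1 a

include hq' in
theorem gaussBinom_zero_right (a : ℕ) : gaussBinom q a 0 = 1 :=
  div_self (qPoch_ne_zero hq' 0 a)

theorem gaussBinom_zero_left (k : ℕ) : gaussBinom q 0 k = 1 := by
  simp [gaussBinom, qPoch]

include hq' in
theorem gaussBinom_succ_succ (a k : ℕ) :
    gaussBinom q (a + 1) (k + 1) = gaussBinom q a (k + 1) + q ^ (a + 1) * gaussBinom q (a + 1) k := by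
  have h1 : qPoch q 1 a ≠ 0 := qPoch_ne_zero hq' 0 a
  have h2 : (1 - q ^ (1 + a)) ≠ 0 := sub_ne_zero.2 (by rw [add_comm]; exact (hq' a).symm)
  have e1 : ∀ b, qPoch q b (a + 1) = qPoch q b a * (1 - q ^ (b + a)) := fun b => by
    simp [qPoch, prod_range_succ]
  have e2 : qPoch q (k + 1) (a + 1) = (1 - q ^ (k + 1)) * qPoch q (k + 1 + 1) a := by
    rw [add_comm a, qPoch_add]
    simp [qPoch]
  rw [gaussBinom, gaussBinom, gaussBinom, e2, e1, e1]
  field_simp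
  ring

include hq' in
/-- The `q`-Vandermonde convolution. -/
theorem sum_gaussBinom (a b c : ℕ) :
    ∑ k ∈ range (c + 1), q ^ (k * (b + 1)) * gaussBinom q a k * gaussBinom q b (c - k) =
      gaussBinom q (a + b + 1) c := by
  induction a generalizing c with
  | zero =>
    induction c with
    | zero => simp [gaussBinom_zero_right hq']
    | succ c ih =>
      rw [sum_range_succ', zero_add, gaussBinom_succ_succ hq']
      rw [zero_add] at ih
      rw [← ih, mul_sum, add_comm]
      simp only [gaussBinom_zero_left]
      congr 1
      · simp
      · refine sum_congr rfl fun k _ => ?_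
        rw [Nat.add_sub_add_right]
        ring
  | succ a ih =>
    induction c with
    | zero => simp [gaussBinom_zero_right hq']
    | succ c ih' =>
      rw [gaussBinom_succ_succ hq', ← ih', add_right_comm a 1 b, ← ih (c + 1), sum_range_succ' _ (c + 1),
        sum_range_succ' _ (c + 1), mul_sum, add_right_comm, ← sum_add_distrib]
      simp only [gaussBinom_zero_right hq']
      congr 1
      refine sum_congr rfl fun k _ => ?_
      rw [Nat.add_sub_add_right, gaussBinom_succ_succ hq']
      ring

end SparsePolynomials

/-! ### Normalisation by induction on p -/

section ClosedForm

variable {K : Type*} [Field K] {q : K} (hq : q ≠ 0) (hq' : ∀ m, q ^ (m + 1) ≠ 1)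

include hq hq' in
theorem refinedSum_eq_mul {p c k : ℕ} (hk : k ≤ c) :
    refinedSum q p c k = refinedSum q p c 0 / gaussBinom q p c *
      (q ^ (k * (p + 1)) * gaussBinom q p k * gaussBinom q p (c - k)) := by
  have h := refinedSum_mul_refinedWeight hq hq' (p := p) hk
  have h1 : qPoch q 1 p ≠ 0 := qPoch_ne_zero hq' 0 p
  have h2 : qPoch q (c + 1) p ≠ 0 := qPoch_ne_zero hq' c p
  simp only [refinedWeight, zero_mul, pow_zero, one_mul, zero_add, Nat.sub_zero] at h
  simp only [gaussBinom]
  field_simp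
  linear_combination h

include hq hq' in
-- By q-Vandermonde, passing from p to p + 1 multiplies by `gaussBinom q (2p+1) c / gaussBinom q p
-- c`, which is the new factor of the product.
theorem refinedSum_zero (p c : ℕ) :
    refinedSum q p c 0 =
      ∏ i ∈ Icc 1 p, qPoch q (c + i) i / qPoch q i i := by
  induction p with
  | zero =>
    -- Setting z = 0 isolates k = 0, and then only the empty shape contributes.
    have h := sum_fillingSum q (0 : K) 0 c
    rw [sum_range_succ'] at h
    simp only [pow_succ, mul_zero, sum_const_zero, pow_zero, mul_one, zero_add] at h
    rw [← h, Icc_eq_empty (by simp), prod_empty]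
    rw [sum_eq_single (fun _ => 0)]
    · rw [fillingSum_zero _ _ _ (Nat.zero_le _)]
      simp
    · intro l hl hne
      have := (mem_strictMonoBelow.1 hl).2 0
      rw [fillingSum_zero _ _ _ (by omega), mul_zero, zero_pow]
      intro h0
      refine hne (funext fun i => ?_)
      rw [Subsingleton.elim (α := Fin 1) i 0, h0]
    · intro h0
      exact absurd (mem_strictMonoBelow.2 ⟨fun i j hij => by
        rw [Subsingleton.elim (α := Fin 1) i j] at hij; exact absurd hij (lt_irrefl _),
        fun _ => by omega⟩) h0
  | succ p ih =>
    rw [refinedSum_succ_zero, sum_congr rfl fun k hk =>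
      refinedSum_eq_mul hq hq' (Nat.lt_succ_iff.1 (mem_range.1 hk)), ← mul_sum,
      sum_gaussBinom hq', ih, prod_Icc_succ_top (by omega), div_mul_eq_mul_div, mul_div_assoc]
    congr 1
    have h1 : qPoch q 1 p ≠ 0 := qPoch_ne_zero hq' 0 p
    have h2 : qPoch q (c + 1) p ≠ 0 := qPoch_ne_zero hq' c p
    have h3 : qPoch q (p + 1) (p + 1) ≠ 0 := qPoch_ne_zero hq' p (p + 1)
    rw [gaussBinom, gaussBinom, add_assoc p p 1, qPoch_add, qPoch_add 1, add_comm 1 p,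
      show c + 1 + p = c + (p + 1) by ring]
    field_simp

end ClosedForm

/-! ### Specialisation to ℚ(q) -/

theorem RatFunc.X_pow_succ_ne_one (m : ℕ) : (RatFunc.X : RatFunc ℚ) ^ (m + 1) ≠ 1 := by
  rw [← RatFunc.algebraMap_X, ← map_pow, ← map_one (algebraMap (Polynomial ℚ) (RatFunc ℚ))]
  intro h
  have h1 := congrArg Polynomial.natDegree (RatFunc.algebraMap_injective ℚ h)
  simp at h1

theorem one_sub_X_ne_zero : (1 - RatFunc.X : RatFunc ℚ) ≠ 0 :=
  sub_ne_zero.2 fun h => RatFunc.X_pow_succ_ne_one 0 (by simpa using h.symm)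

theorem qRising_eq (a m : ℕ) :
    qRising a m = qPoch (RatFunc.X : RatFunc ℚ) a m / (1 - RatFunc.X) ^ m := by
  have h : ∀ b : ℕ, qInt b = (1 - RatFunc.X ^ b) / (1 - RatFunc.X) := fun b => by
    rw [eq_div_iff one_sub_X_ne_zero, mul_comm]
    exact mul_neg_geom_sum _ _
  simp only [qRising, qPoch, h, prod_div_distrib, prod_const, card_range]

/-- The leading factors 1 - q^(c+i) of the numerators are split off; together they cancel the
numerator of `gaussBinom q p c`. -/
theorem prod_qPoch_eq {K : Type*} [Field K] (q : K) (p c : ℕ) :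
    ∏ i ∈ Icc 1 p, qPoch q (c + i) i / qPoch q i i =
      qPoch q (c + 1) p * ∏ i ∈ Icc 1 p, qPoch q (c + i + 1) (i - 1) / qPoch q i i := by
  induction p with
  | zero => simp [qPoch]
  | succ p ih =>
    have h1 : qPoch q (c + (p + 1)) (p + 1) =
        qPoch q (c + 1 + p) 1 * qPoch q (c + (p + 1) + 1) p := by
      rw [show c + 1 + p = c + (p + 1) by ring, ← qPoch_add, add_comm 1 p]
    rw [prod_Icc_succ_top (by omega), prod_Icc_succ_top (by omega), ih, h1, qPoch_add (c + 1) p 1,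
      Nat.add_sub_cancel]
    ring

/-- The refined Bender–Knuth generating function. Finiteness of the set of strict plane partitions
is part of the conclusion, so that the sum is a genuine finite sum in `ℚ(q)`. -/
theorem theorem1 (n c k : ℕ) (hn : 1 ≤ n) (hk : k ≤ c) :
    (StrictPlanePartition.refined n c k).Finite ∧
      ∑ᶠ π ∈ StrictPlanePartition.refined n c k, (RatFunc.X : RatFunc ℚ) ^ π.norm =
        RatFunc.X ^ (k * n) * qRising (k + 1) (n - 1) * qRising (1 + c - k) (n - 1)
            / qRising 1 (n - 1)
          * ∏ i ∈ Finset.Icc 1 (n - 1), qRising (c + i + 1) (i - 1) / qRising i i := by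
  obtain ⟨p, rfl⟩ : ∃ p, n = p + 1 := ⟨n - 1, by omega⟩
  refine ⟨(StrictPlanePartition.finite_bounded p c).subset
    (StrictPlanePartition.refined_subset_bounded _ _ _), ?_⟩
  have hq' := RatFunc.X_pow_succ_ne_one
  have hs := one_sub_X_ne_zero
  have h1 : qPoch (RatFunc.X : RatFunc ℚ) 1 p ≠ 0 := qPoch_ne_zero hq' 0 p
  have h2 : qPoch (RatFunc.X : RatFunc ℚ) (c + 1) p ≠ 0 := qPoch_ne_zero hq' c p
  -- Each quotient has one more q-integer below than above, hence one spare factor 1 - q for each i.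
  have h3 : ∏ i ∈ Icc 1 p, qRising (c + i + 1) (i - 1) / qRising i i =
      (∏ i ∈ Icc 1 p, qPoch (RatFunc.X : RatFunc ℚ) (c + i + 1) (i - 1) /
        qPoch (RatFunc.X : RatFunc ℚ) i i) * (1 - RatFunc.X) ^ p := by
    have e : ∏ _i ∈ Icc 1 p, (1 - RatFunc.X : RatFunc ℚ) = (1 - RatFunc.X) ^ p := by simp
    rw [← e, ← prod_mul_distrib]
    refine prod_congr rfl fun i hi => ?_
    obtain ⟨j, rfl⟩ : ∃ j, i = j + 1 := ⟨i - 1, by have := mem_Icc.1 hi; omega⟩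
    have h4 : qPoch (RatFunc.X : RatFunc ℚ) (j + 1) (j + 1) ≠ 0 := qPoch_ne_zero hq' j (j + 1)
    rw [qRising_eq, qRising_eq, Nat.add_sub_cancel]
    field_simp
    ring
  rw [finsum_refined, refinedSum_eq_mul RatFunc.X_ne_zero hq' hk,
    refinedSum_zero RatFunc.X_ne_zero hq', prod_qPoch_eq, Nat.add_sub_cancel, h3, qRising_eq,
    qRising_eq, qRising_eq, gaussBinom, gaussBinom, gaussBinom,
    show 1 + c - k = c - k + 1 by omega]
  generalize ∏ i ∈ Icc 1 p, qPoch (RatFunc.X : RatFunc ℚ) (c + i + 1) (i - 1) /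
        qPoch (RatFunc.X : RatFunc ℚ) i i = P
  field_simp
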